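/- **Setting.** Vectors of $\mathbb C^{n+1}$ are labelled $x=(x_0,\dots,x_n)$; $\|\cdot\|$ is the Euclidean (Hilbert–Schmidt) norm; $c^{1/m}$ is the principal $m$-th root. Let $n,m,k,p,r$ be nonnegative integers with $1\le p\le m-2$ and $r\le\min\left(\binom{k}{p},\binom{n-k-1}{m-p-1}\right)$. Let $\Omega_m$ be the set of tuples $(i_1,\dots,i_m)\in\{0,\dots,n\}^m$ with pairwise distinct entries. Squarefree monomials in $x_1,\dots,x_n$ are identified with their exponents; for a symmetric tensor $\mathcal F$ of order $m$ and a monomial $x^\alpha=x_{i_1}\cdots x_{i_s}$, $s\le m$, put $\mathcal F_\alpha=\mathcal F_{i_1\cdots i_s0\cdots0}$. For a set $\mathscr B$ of monomials, $[x]_{\mathscr B}$ is the vector of their values at $(x_1,\dots,x_n)$. Let * $J_1=\{x_{i_1}\cdots x_{i_p}:1\le i_1<\dots<i_p\le k\}$, let $J_1^{-j}$ be the monomials of $J_1$ not containing $x_j$, and let $J_2=\{x_{i_1}\cdots x_{i_{m-p-1}}:k<i_1<\dots<i_{m-p-1}\le n\}$; * $\mathscr B_0$ be the first $r$ monomials of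 $J_1$ in the graded lexicographic order (listed from $x_1\cdots x_p$ on), and $\mathscr B_1=\{x_{j_1}\cdots x_{j_{p+1}}:1\le j_1<\dots<j_p\le k<j_{p+1}\le n\}$; * $\mathcal O_\alpha$, for $\alpha=e_{j_1}+\dots+e_{j_{p+1}}\in\mathscr B_1$, be the monomials of $J_2$ not containing $x_{j_{p+1}}$; * $A[\alpha,\mathcal F]=(\mathcal F_{\beta+\gamma})_{\gamma\in\mathcal O_\alpha,\beta\in\mathscr B_0}$ and $b[\alpha,\mathcal F]=(\mathcal F_{\alpha+\gamma})_{\gamma\in\mathcal O_\alpha}$; * for $G\in\mathbb C^{\mathscr B_0\times\mathscr B_1}$ and $\xi=(\xi_{k+1},\dots,\xi_n)\in\mathbb C^{n-k}$, $N_l(G)_{\nu,\beta}=G(\beta,\nu+e_l)$ ($\nu,\beta\in\mathscr B_0$, $k<l\le n$) and $N(\xi)=\sum_{l=k+1}^n\xi_lN_l(G)$. **Algorithm** (input: a symmetric tensor $\widehat{\mathcal F}$, used only through its entries with labels in $\Omega_m$, and $\xi$). 1. For each $\alpha\in\mathscr B_1$ let $\widehat G(:,\alpha)$ minimize $\|A[\alpha,\widehat{\mathcal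 F}]g-b[\alpha,\widehat{\mathcal F}]\|^2$ over $g\in\mathbb C^{\mathscr B_0}$. 2. Let $\hat z_1,\dots,\hat z_r$ be linearly independent unit eigenvectors of $\widehat N(\xi)=\sum_l\xi_lN_l(\widehat G)$, and $\hat w_i=(\hat z_i^HN_l(\widehat G)\hat z_i)_{l=k+1,\dots,n}$. 3. Let $(\hat\gamma_i)_i$, $\hat\gamma_i\in\mathbb C^{J_1}$, minimize $\sum_{\beta\in J_1,\,S\in J_2}\left|\widehat{\mathcal F}_{\beta+S}-\sum_i(\gamma_i)_\beta\,\hat w_i^{S}\right|^2$, where $\hat w_i^S=\prod_{l\in S}(\hat w_i)_l$. For each $1\le j\le k$ let $((\hat v_i)_j)_i\in\mathbb C^r$ minimize $\sum_{\beta\in J_1^{-j},\,S\in J_2}\left|\widehat{\mathcal F}_{e_j+\beta+S}-\sum_i(v_i)_j(\hat\gamma_i)_\beta\,\hat w_i^{S}\right|^2$. With $\hat u_i=(\hat v_i,\hat w_i)$, let $(\hat\lambda_i)_i\in\mathbb C^r$ minimize $\left\|\left(\widehat{\mathcal F}-\sum_i\lambda_i(1,\hat u_i)^{\otimes m}\right)_{\Omega_m}\right\|^2$.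 4. Put $\hat q_i=\hat\lambda_i^{1/m}(1,\hat v_i,\hat w_i)$, and let $(q_1^*,\dots,q_r^*)$ be a minimizer of $\left\|\left(\widehat{\mathcal F}-\sum_iq_i^{\otimes m}\right)_{\Omega_m}\right\|^2$ over $(\mathbb C^{n+1})^r$. **Theorem.** For every tensor $\mathcal F$ of order $m$ over $\mathbb C^{n+1}$ and every $\xi\in\mathbb C^{n-k}$ there are $\varepsilon_0,C>0$ (depending only on $\mathcal F$, $\xi$ and the integers above) such that the following holds. Let $\mathcal F=\sum_{i=1}^r\omega_i\mu_i^{\otimes m}$ with $\omega_i\in\mathbb C$, $\mu_i\in\mathbb C^{n+1}$, such that * (i) all $\omega_i$ and all leading entries $(\mu_i)_0$ are nonzero; * (ii) the vectors $[\mu_i]_{\mathscr B_0}$, $i=1,\dots,r$, are linearly independent; * (iii) for every $\alpha\in\mathscr B_1$ the vectors $[\mu_i]_{\mathcal O_\alpha}$, $i=1,\dots,r$, are linearly independent; * (iv) the eigenvalues of $N(\xi)$, for the matrix $G$ determined by $A[\alpha,\mathcal F]\,G(:,\alpha)=b[\alpha,\mathcal F]$ ($\alpha\in\mathscr B_1$),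 are pairwise distinct. Put $q_i=\omega_i^{1/m}\mu_i$. Let $\widehat{\mathcal F}$ be a symmetric tensor with $\varepsilon:=\|(\widehat{\mathcal F}-\mathcal F)_{\Omega_m}\|<\varepsilon_0$. Then the algorithm can be carried out on $\widehat{\mathcal F}$ with $\xi$ (all the eigenvectors and minimizers exist), and for all possible choices of these: * there are a permutation $\sigma$ and scalars $\eta_i^*$ with $(\eta_i^*)^m=1$ and $\|\eta_i^*q_i^*-q_{\sigma(i)}\|\le C\varepsilon$ for all $i$; * if moreover, for all $i$ and all $1\le j\le k$, $[\mu_i]_{J_1^{-j}}\ne0$ (equivalently, each $\mu_i$ has at least $p+1$ nonzero entries among $(\mu_i)_1,\dots,(\mu_i)_k$), then there are a permutation $\hat\sigma$ and scalars $\hat\eta_i$ with $\hat\eta_i^m=1$ and $\|\hat\eta_i\hat q_i-q_{\hat\sigma(i)}\|\le C\varepsilon$ for all $i$. -/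

import Mathlib

/-! Vectors of `ℂ^(n+1)` and tensors of order `m` over `ℂ^(n+1)` are labelled by `0, …, n`.
A squarefree monomial `x_{i₁} ⋯ x_{iₛ}` with `1 ≤ i₁ < ⋯ < iₛ ≤ n` is represented by the finite
set `{i₁, …, iₛ}` of its indices, inside `Fin (n + 1)`. -/

noncomputable section

namespace IncompleteTensor

/-- Vectors `(x₀, …, xₙ)` of `ℂ^(n+1)` with the Euclidean norm. -/
abbrev Vec (n : ℕ) := EuclideanSpace ℂ (Fin (n + 1))

/-- Tensors of order `m` over `ℂ^(n+1)`. -/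
abbrev Tensor (m n : ℕ) := (Fin m → Fin (n + 1)) → ℂ

variable {m n r : ℕ}

/-- The entries are invariant under permutations of the labels. -/
def IsSymmetric (F : Tensor m n) : Prop :=
  ∀ (σ : Equiv.Perm (Fin m)) (t : Fin m → Fin (n + 1)), F (t ∘ σ) = F t

/-- The tensor power `x^{⊗ m}`. -/
def tensorPower (m : ℕ) (x : Vec n) : Tensor m n := fun t => ∏ s, x (t s)

/-- The label set `Ω_m` of tuples `(i₁, …, i_m)` with pairwise distinct entries. -/
def Omega (m n : ℕ) : Finset (Fin m → Fin (n + 1)) :=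
  Finset.univ.filter Function.Injective

/-- `‖(F - F')_{Ω_m}‖²`, in the Hilbert–Schmidt norm. -/
def sqDistOmega (F F' : Tensor m n) : ℝ := ∑ t ∈ Omega m n, ‖F t - F' t‖ ^ 2

/-- `‖(F - F')_{Ω_m}‖`. -/
def distOmega (F F' : Tensor m n) : ℝ := Real.sqrt (sqDistOmega F F')

/-- The label `(i₁, …, iₛ, 0, …, 0)` of length `m` of the monomial `x_{i₁} ⋯ x_{iₛ}`. -/
def label (m : ℕ) (S : Finset (Fin (n + 1))) : Fin m → Fin (n + 1) := fun t =>
  if h : (t : ℕ) < S.card then S.orderEmbOfFin rfl ⟨t, h⟩ else 0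

/-- The entry `F_α` of a symmetric tensor at a squarefree monomial `x^α` of degree at most `m`
(the label is filled up with zeros, as `x₀ = 1`). -/
def entry (F : Tensor m n) (S : Finset (Fin (n + 1))) : ℂ := F (label m S)

/-- The value of the squarefree monomial `S` at the point `x`. -/
def evalMono (x : Fin (n + 1) → ℂ) (S : Finset (Fin (n + 1))) : ℂ := ∏ j ∈ S, x j

/-- The indices `1, …, k`. -/
def low (n k : ℕ) : Finset (Fin (n + 1)) :=
  Finset.univ.filter fun j => 1 ≤ (j : ℕ) ∧ (j : ℕ) ≤ k

/-- The indices `k + 1, …, n`. -/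
def high (n k : ℕ) : Finset (Fin (n + 1)) :=
  Finset.univ.filter fun j => k < (j : ℕ)

/-- `J₁`: the monomials `x_{i₁} ⋯ x_{iₚ}` with `1 ≤ i₁ < ⋯ < iₚ ≤ k`. -/
def J1 (n k p : ℕ) : Finset (Finset (Fin (n + 1))) := (low n k).powersetCard p

/-- `J₁^{-j}`: the monomials of `J₁` that do not contain `x_j`. -/
def J1minus (n k p : ℕ) (j : Fin (n + 1)) : Finset (Finset (Fin (n + 1))) :=
  (J1 n k p).filter fun S => j ∉ S

/-- `J₂`: the monomials `x_{i₁} ⋯ x_{i_{m-p-1}}` with `k + 1 ≤ i₁ < ⋯ < i_{m-p-1} ≤ n`. -/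
def J2 (n m k p : ℕ) : Finset (Finset (Fin (n + 1))) := (high n k).powersetCard (m - p - 1)

/-- For monomials of the same degree: `T` comes before `S` in the graded lexicographic listing
`x₁x₂⋯`, …, i.e. at the smallest index where they differ, the variable divides `T`. -/
def Precedes (T S : Finset (Fin (n + 1))) : Prop :=
  ∃ i, i ∈ T ∧ i ∉ S ∧ ∀ j, j < i → (j ∈ T ↔ j ∈ S)

instance (T S : Finset (Fin (n + 1))) : Decidable (Precedes T S) := by
  unfold Precedes; infer_instance

/-- `𝓑₀`: the first `r` monomials of `J₁` in the graded lexicographic order. -/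
def B0 (n k p r : ℕ) : Finset (Finset (Fin (n + 1))) :=
  (J1 n k p).filter fun S => ((J1 n k p).filter fun T => Precedes T S).card < r

/-- `𝓑₁`: the monomials `x_{j₁} ⋯ x_{j_{p+1}}` with
`1 ≤ j₁ < ⋯ < jₚ ≤ k < j_{p+1} ≤ n`. -/
def B1 (n k p : ℕ) : Finset (Finset (Fin (n + 1))) :=
  Finset.image₂ insert (high n k) (J1 n k p)

/-- `𝓞_α` for `α ∈ 𝓑₁`: the monomials of `J₂` that do not contain `x_{j_{p+1}}`, the only
variable of `α` with index above `k`. -/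
def O (n m k p : ℕ) (α : Finset (Fin (n + 1))) : Finset (Finset (Fin (n + 1))) :=
  (J2 n m k p).filter fun γ => Disjoint γ α

theorem insert_mem_B1 {k p : ℕ} {l : Fin (n + 1)} {ν : Finset (Fin (n + 1))}
    (hl : l ∈ high n k) (hν : ν ∈ B0 n k p r) : insert l ν ∈ B1 n k p :=
  Finset.mem_image₂_of_mem hl (Finset.mem_filter.mp hν).1

/-- The matrix `A[α, F]`, with entries `F_{β+γ}`. -/
def matA (k p r : ℕ) (F : Tensor m n) (α : Finset (Fin (n + 1))) :
    Matrix ↥(O n m k p α) ↥(B0 n k p r) ℂ :=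
  Matrix.of fun γ β => entry F (β.1 ∪ γ.1)

/-- The vector `b[α, F]`, with entries `F_{α+γ}`. -/
def vecB (k p : ℕ) (F : Tensor m n) (α : Finset (Fin (n + 1))) : ↥(O n m k p α) → ℂ :=
  fun γ => entry F (α ∪ γ.1)

/-- The linear systems `A[α, F] G(:, α) = b[α, F]`, for all `α ∈ 𝓑₁`. -/
def SolvesG (k p r : ℕ) (F : Tensor m n) (G : Matrix ↥(B0 n k p r) ↥(B1 n k p) ℂ) : Prop :=
  ∀ α : ↥(B1 n k p), (matA k p r F α.1).mulVec (fun β => G β α) = vecB k p F α.1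

/-- The matrix `N_l(G)` with entries `N_l(G)_{ν,β} = G(β, ν + e_l)`, for `l = k + 1, …, n`. -/
def matN {k p : ℕ} (G : Matrix ↥(B0 n k p r) ↥(B1 n k p) ℂ) (l : ↥(high n k)) :
    Matrix ↥(B0 n k p r) ↥(B0 n k p r) ℂ :=
  Matrix.of fun ν β => G β ⟨insert l.1 ν.1, insert_mem_B1 l.2 ν.2⟩

/-- `N(ξ) = ξ_{k+1} N_{k+1}(G) + ⋯ + ξ_n N_n(G)`. -/
def matNxi {k p : ℕ} (ξ : ↥(high n k) → ℂ) (G : Matrix ↥(B0 n k p r) ↥(B1 n k p) ℂ) :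
    Matrix ↥(B0 n k p r) ↥(B0 n k p r) ℂ :=
  ∑ l, ξ l • matN G l

/-- The vector `w` with entries `w_l = v^H N_l(G) v`, for `l = k + 1, …, n`
(extended by zero to the other labels, which are never used). -/
def wVec {k p : ℕ} (G : Matrix ↥(B0 n k p r) ↥(B1 n k p) ℂ)
    (v : EuclideanSpace ℂ ↥(B0 n k p r)) : Fin (n + 1) → ℂ := fun l =>
  if h : l ∈ high n k then
    dotProduct (star v.ofLp) ((matN G ⟨l, h⟩).mulVec v.ofLp)
  else 0

/-- Objective for a column of the generating matrix: `‖A[α, F] g - b[α, F]‖²`. -/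
def objG (k p r : ℕ) (F : Tensor m n) (α : Finset (Fin (n + 1)))
    (g : ↥(B0 n k p r) → ℂ) : ℝ :=
  ∑ γ, ‖(matA k p r F α).mulVec g γ - vecB k p F α γ‖ ^ 2

/-- Objective `‖F_{J₁·J₂} - ∑ᵢ γᵢ ⊗ [wᵢ]_{J₃}‖²` in the unknowns `γᵢ ∈ ℂ^{J₁}`.
(`J₃` is `J₂` with the indices shifted by `k`; here `w` keeps its labels `k + 1, …, n`.) -/
def objGamma (k p : ℕ) (F : Tensor m n) (w : Fin r → Fin (n + 1) → ℂ)
    (γ : Fin r → ↥(J1 n k p) → ℂ) : ℝ :=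
  ∑ β : ↥(J1 n k p), ∑ S ∈ J2 n m k p,
    ‖entry F (β.1 ∪ S) - ∑ i, γ i β * evalMono (w i) S‖ ^ 2

/-- Objective `‖F_{x_j·J₁^{-j}·J₂} - ∑ᵢ (vᵢ)_j γᵢ ⊗ [wᵢ]_{J₃}‖²` in the unknowns
`x i = (vᵢ)_j`; the `γᵢ` are restricted to `J₁^{-j}`. -/
def objV (k p : ℕ) (F : Tensor m n) (w : Fin r → Fin (n + 1) → ℂ)
    (γ : Fin r → ↥(J1 n k p) → ℂ) (j : Fin (n + 1)) (x : Fin r → ℂ) : ℝ :=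
  ∑ β ∈ (Finset.univ : Finset ↥(J1 n k p)).filter (fun β => j ∉ β.1), ∑ S ∈ J2 n m k p,
    ‖entry F (insert j (β.1 ∪ S)) - ∑ i, x i * γ i β * evalMono (w i) S‖ ^ 2

/-- The vector `(1, v, w)`. -/
def assemble {k : ℕ} (v : ↥(low n k) → ℂ) (w : Fin (n + 1) → ℂ) : Vec n :=
  WithLp.toLp 2 fun j =>
    if j = 0 then 1 else if h : j ∈ low n k then v ⟨j, h⟩ else w j

/-- Objective `‖F_{Ω_m} - ∑ᵢ λᵢ ((1, uᵢ)^{⊗ m})_{Ω_m}‖²` in the unknowns `λᵢ`. -/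
def objLambda (F : Tensor m n) (u : Fin r → Vec n) (lam : Fin r → ℂ) : ℝ :=
  sqDistOmega F (∑ i, lam i • tensorPower m (u i))

/-- Objective `‖F_{Ω_m} - ∑ᵢ (qᵢ^{⊗ m})_{Ω_m}‖²` in the unknowns `qᵢ`. -/
def objQ (F : Tensor m n) (q : Fin r → Vec n) : ℝ :=
  sqDistOmega F (∑ i, tensorPower m (q i))

/-- A run of the incomplete symmetric tensor approximation algorithm on the input `F`, with the
vector `ξ`: all choices made on the way (the minimizers, and the unit eigenvectors with their
order and phases). -/
structure AlgorithmRun (k p r : ℕ) (F : Tensor m n) (ξ : ↥(high n k) → ℂ) where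
  /-- The approximate generating matrix. -/
  G : Matrix ↥(B0 n k p r) ↥(B1 n k p) ℂ
  G_min : ∀ α : ↥(B1 n k p), IsMinOn (objG k p r F α.1) Set.univ (fun β => G β α)
  /-- The unit length eigenvectors of `N(ξ)` (a full system), and their eigenvalues. -/
  vec : Fin r → EuclideanSpace ℂ ↥(B0 n k p r)
  eig : Fin r → ℂ
  vec_norm : ∀ i, ‖vec i‖ = 1
  vec_eig : ∀ i, (matNxi ξ G).mulVec (vec i).ofLp = eig i • (vec i).ofLp
  vec_indep : LinearIndependent ℂ vec
  /-- The vectors obtained by the first linear least squares problem. -/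
  gam : Fin r → ↥(J1 n k p) → ℂ
  gam_min : IsMinOn (objGamma k p F fun i => wVec G (vec i)) Set.univ gam
  /-- The vectors `v̂ᵢ = ((v̂ᵢ)₁, …, (v̂ᵢ)ₖ)`. -/
  v : Fin r → ↥(low n k) → ℂ
  v_min : ∀ j : ↥(low n k),
    IsMinOn (objV k p F (fun i => wVec G (vec i)) gam j.1) Set.univ (fun i => v i j)
  /-- The scalars `λ̂ᵢ`. -/
  lam : Fin r → ℂ
  lam_min : IsMinOn (objLambda F fun i => assemble (v i) (wVec G (vec i))) Set.univ lam
  /-- The output vectors `qᵢ*`. -/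
  qstar : Fin r → Vec n
  qstar_min : IsMinOn (objQ F) Set.univ qstar

/-- `q̂ᵢ = (λ̂ᵢ)^{1/m} (1, v̂ᵢ, ŵᵢ)`, with the principal `m`th root. -/
def AlgorithmRun.qhat {k p : ℕ} {F : Tensor m n} {ξ : ↥(high n k) → ℂ}
    (R : AlgorithmRun k p r F ξ) (i : Fin r) : Vec n :=
  (R.lam i ^ (1 / (m : ℂ))) • assemble (R.v i) (wVec R.G (R.vec i))

/-- Up to `m`th roots of unity and a permutation, the vectors `a i` are within distance `δ`
of the vectors `q i`. -/
def CloseUpToRoots (m : ℕ) (a q : Fin r → Vec n) (δ : ℝ) : Prop :=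
  ∃ (σ : Equiv.Perm (Fin r)) (η : Fin r → ℂ),
    (∀ i, η i ^ m = 1) ∧ ∀ i, ‖η i • a i - q (σ i)‖ ≤ δ

end IncompleteTensor

end

/-! Normalise the decomposition to `∑ lam i • (u i)^{⊗ m}` with `u i 0 = 1`. The matrix `A[α, F]`
factors through the values of the `u i` on `𝓞_α`, the diagonal matrix of the `lam i`, and the values
on `𝓑₀`. So (i)-(iii) make it injective, and the solution `G` is the matrix expressing the monomials
of `𝓑₁` by those of `𝓑₀` at the points `u i`. Hence the vectors `[u i]_{𝓑₀}` are common eigenvectors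
of all `N_l(G)`, with eigenvalues `u i l`.

Least squares problems whose limit is consistent and injective are stable with error `O(ε)`
(`near_of_leastSquares`), which controls `Ĝ`. Simplicity of the spectrum of `N(ξ)` controls the
eigenlines (`exists_perm_eigenvectors_near`), and Rayleigh quotients turn these into the `ŵᵢ`
(`near_rayleigh`). The remaining algebraic steps are again stable least squares problems, which
gives the bound for `q̂`.

For `q*` the same theory is applied to an arbitrary sum of `r` powers near `F`. Injectivity of `A[α,
·]` survives the perturbation and forces the nearby decomposition to be nondegenerate
(`nondegenerate_of_injective`), so its own generating matrix solves the nearby systems exactly. Its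
points are thus within a constant times the distance of the tensors (`exists_stability`). This
bounds a sublevel set of the objective, so that minimizers exist, and the triangle inequality puts
them `O(ε)` away. At distance zero it says that the decomposition is unique up to order and roots of
unity, so constants found for one decomposition of `F` serve for all.

Uniform constants come from working along `comap d (𝓝 0)` on the type of all perturbed tensors, of
all families of points, or of all pairs of a tensor and a run. -/

noncomputable section

namespace IncompleteTensor

open Filter Topology Asymptotics

/-! ### Calculus of limits with error `O(d)` -/

/-- `f` tends to `a` along `l`, with an error that is `O(d)`. -/
def Near {T : Type*} (l : Filter T) (d : T → ℝ) (f : T → ℂ) (a : ℂ) : Prop :=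
  (fun t => f t - a) =O[l] d

section NearCalculus

variable {T : Type*} {l : Filter T} {d : T → ℝ} {f g : T → ℂ} {a b : ℂ}

theorem Near.const (a : ℂ) : Near l d (fun _ => a) a := by
  simpa [Near] using isBigO_zero d l

theorem Near.congr' (hf : Near l d f a) (h : f =ᶠ[l] g) : Near l d g a := by
  refine IsBigO.congr' hf ?_ EventuallyEq.rfl
  filter_upwards [h] with t ht using by rw [ht]

theorem Near.tendsto (hd : Tendsto d l (𝓝 0)) (hf : Near l d f a) : Tendsto f l (𝓝 a) :=
  tendsto_sub_nhds_zero_iff.mp (hf.trans_tendsto hd)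

theorem Near.isBigO_one (hd : Tendsto d l (𝓝 0)) (hf : Near l d f a) :
    f =O[l] (fun _ => (1 : ℝ)) :=
  (hf.tendsto hd).isBigO_one ℝ

theorem Near.add (hf : Near l d f a) (hg : Near l d g b) :
    Near l d (fun t => f t + g t) (a + b) := by
  refine (IsBigO.add hf hg).congr_left fun t => ?_
  ring

theorem Near.mul (hd : Tendsto d l (𝓝 0)) (hf : Near l d f a) (hg : Near l d g b) :
    Near l d (fun t => f t * g t) (a * b) := by
  have h1 : (fun t => (f t - a) * g t) =O[l] d := by
    simpa using IsBigO.mul hf (hg.isBigO_one hd)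
  have h2 : (fun t => a * (g t - b)) =O[l] d := IsBigO.const_mul_left hg a
  refine (h1.add h2).congr_left fun t => ?_
  ring

theorem Near.sum {ι : Type*} (s : Finset ι) {f : ι → T → ℂ} {a : ι → ℂ}
    (h : ∀ i ∈ s, Near l d (f i) (a i)) :
    Near l d (fun t => ∑ i ∈ s, f i t) (∑ i ∈ s, a i) := by
  refine (IsBigO.fun_sum (g := d) (A := fun i t => f i t - a i) h).congr_left fun t => ?_
  simp

theorem Near.prod (hd : Tendsto d l (𝓝 0)) {ι : Type*} (s : Finset ι) {f : ι → T → ℂ}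
    {a : ι → ℂ} (h : ∀ i ∈ s, Near l d (f i) (a i)) :
    Near l d (fun t => ∏ i ∈ s, f i t) (∏ i ∈ s, a i) := by
  classical
  induction s using Finset.induction_on with
  | empty => simpa using Near.const (l := l) (d := d) 1
  | insert i s hi ih =>
    simp only [Finset.prod_insert hi]
    exact (h i (by simp)).mul hd (ih fun j hj => h j (by simp [hj]))

theorem Near.eventually_ne (hd : Tendsto d l (𝓝 0)) (hf : Near l d f a) (ha : a ≠ 0) :
    ∀ᶠ t in l, f t ≠ 0 :=
  (hf.tendsto hd).eventually_ne ha

theorem Near.inv (hd : Tendsto d l (𝓝 0)) (hf : Near l d f a) (ha : a ≠ 0) :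
    Near l d (fun t => (f t)⁻¹) a⁻¹ := by
  have h0 := hf.eventually_ne hd ha
  have h1 : (fun t => (f t)⁻¹) =O[l] (fun _ => (1 : ℝ)) :=
    ((hf.tendsto hd).inv₀ ha).isBigO_one ℝ
  have h2 : (fun t => -((f t - a) * (f t)⁻¹ * a⁻¹)) =O[l] d := by
    have := ((IsBigO.mul hf h1).mul (isBigO_const_const (a⁻¹) (one_ne_zero' ℝ) l)).neg_left
    simpa using this
  refine h2.congr' ?_ EventuallyEq.rfl
  filter_upwards [h0] with t ht
  field_simp
  ring

theorem Near.div (hd : Tendsto d l (𝓝 0)) (hf : Near l d f a) (hg : Near l d g b)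
    (hb : b ≠ 0) : Near l d (fun t => f t / g t) (a / b) := by
  simpa [div_eq_mul_inv] using hf.mul hd (hg.inv hd hb)

/-- The principal `m`-th root is Lipschitz at `1`, so roots can be matched up to a root of
unity. -/
theorem Near.exists_root {m : ℕ} (hm : m ≠ 0) (hd : Tendsto d l (𝓝 0)) {s : T → ℂ} {s₀ : ℂ}
    (hs : Near l d (fun t => s t ^ m) (s₀ ^ m)) (h₀ : s₀ ≠ 0) :
    ∃ η : T → ℂ, (∀ t, η t ^ m = 1) ∧ Near l d (fun t => η t * s t) s₀ := by
  have hm' : (m : ℂ) ≠ 0 := by exact_mod_cast hm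
  have hp : s₀ ^ m ≠ 0 := pow_ne_zero _ h₀
  -- Dividing by `s₀ ^ m` moves the limit to `1`, away from the branch cut of the principal root, on
  -- which `s₀ ^ m` itself may lie.
  set x : T → ℂ := fun t => s t ^ m / s₀ ^ m with hx
  have hx1 : Near l d x 1 := by
    have := hs.div hd (Near.const (s₀ ^ m)) hp
    rwa [div_self hp] at this
  set y : T → ℂ := fun t => x t ^ (1 / (m : ℂ)) with hy
  have hym : ∀ t, y t ^ m = x t := fun t => by
    simp only [hy]
    rw [one_div, Complex.cpow_nat_inv_pow _ hm]
  have hy1 : Near l d y 1 := by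
    have hdiff : DifferentiableAt ℂ (fun z : ℂ => z ^ (1 / (m : ℂ))) 1 :=
      (differentiableAt_id).cpow_const (by simp [Complex.slitPlane])
    have h1 := hdiff.isBigO_sub.comp_tendsto (hx1.tendsto hd)
    have h2 : (fun t => y t - 1) =O[l] fun t => x t - 1 := by
      simpa [Function.comp_def, hy, one_div] using h1
    exact h2.trans hx1
  have hs0 : ∀ᶠ t in l, s t ≠ 0 := by
    filter_upwards [hs.eventually_ne hd hp] with t ht h
    exact ht (by simp [h, hm])
  -- As `y ^ m = s ^ m / s₀ ^ m`, the quotient `y * s₀ / s` is an `m`-th root of unity, and its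
  -- product with `s` is `y * s₀`. The value `1` covers the zeros of `s`, which eventually do not
  -- occur.
  refine ⟨fun t => if s t = 0 then 1 else y t * s₀ / s t, fun t => ?_, ?_⟩
  · dsimp only
    split_ifs with h
    · simp
    · rw [div_pow, mul_pow, hym, hx]
      field_simp
  · have h1 : Near l d (fun t => y t * s₀) s₀ := by
      simpa using hy1.mul hd (Near.const s₀)
    refine h1.congr' ?_
    filter_upwards [hs0] with t ht
    simp [ht]

end NearCalculus

/-! ### Stability and solvability of linear least squares problems -/

section LeastSquares

variable {T : Type*} {l : Filter T} {d : T → ℝ} {ι κ : Type*} [Fintype κ]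

/-- Injectivity of a matrix is stable under small perturbations, with a uniform bound. -/
theorem exists_lower_bound (hd : Tendsto d l (𝓝 0)) (s : Finset ι) {A : T → ι → κ → ℂ}
    {A₀ : ι → κ → ℂ} (hA : ∀ a ∈ s, ∀ c, Near l d (fun t => A t a c) (A₀ a c))
    (hinj : ∀ y : κ → ℂ, (∀ a ∈ s, ∑ c, A₀ a c * y c = 0) → y = 0) :
    ∃ K : ℝ, 0 < K ∧ ∀ᶠ t in l, ∀ y : κ → ℂ, ‖y‖ ≤ K * ∑ a ∈ s, ‖∑ c, A t a c * y c‖ := by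
  classical
  let L : (κ → ℂ) →ₗ[ℂ] (↥s → ℂ) :=
    Matrix.mulVecLin (Matrix.of fun (a : ↥s) (c : κ) => A₀ a.1 c)
  have hL : ∀ y (a : ↥s), L y a = ∑ c, A₀ a.1 c * y c := fun y a => rfl
  have hker : LinearMap.ker L = ⊥ := by
    rw [LinearMap.ker_eq_bot']
    intro y hy
    refine hinj y fun a ha => ?_
    rw [← hL y ⟨a, ha⟩, hy]
    rfl
  obtain ⟨K, hK, hanti⟩ := L.exists_antilipschitzWith hker
  have hLip : ∀ y : κ → ℂ, ‖y‖ ≤ K * ∑ a ∈ s, ‖∑ c, A₀ a c * y c‖ := by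
    intro y
    have h1 := hanti.le_mul_dist y 0
    rw [map_zero, dist_zero_right, dist_zero_right] at h1
    refine h1.trans (mul_le_mul_of_nonneg_left ?_ K.2)
    rw [pi_norm_le_iff_of_nonneg (Finset.sum_nonneg fun _ _ => norm_nonneg _)]
    intro a
    rw [hL]
    exact Finset.single_le_sum (f := fun a => ‖∑ c, A₀ a c * y c‖)
      (fun _ _ => norm_nonneg _) a.2
  have hK' : (0 : ℝ) < K := hK
  have hsmall : Tendsto (fun t => ∑ a ∈ s, ∑ c, ‖A t a c - A₀ a c‖) l (𝓝 0) := by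
    have : Tendsto (fun t => ∑ a ∈ s, ∑ c, ‖A t a c - A₀ a c‖) l
        (𝓝 (∑ a ∈ s, ∑ c : κ, (0 : ℝ))) := by
      refine tendsto_finsetSum _ fun a ha => tendsto_finsetSum _ fun c _ => ?_
      exact tendsto_zero_iff_norm_tendsto_zero.mp ((hA a ha c).trans_tendsto hd)
    simpa using this
  -- Once the total perturbation of the matrix is below `1 / (2 * K)`, its contribution is at most
  -- `‖y‖ / 2` and is absorbed on the left, which doubles the constant.
  refine ⟨2 * K, by positivity, ?_⟩
  filter_upwards [hsmall.eventually (gt_mem_nhds (show (0 : ℝ) < 1 / (2 * K) by positivity))]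
    with t ht y
  have h1 : ∑ a ∈ s, ‖∑ c, A₀ a c * y c‖ ≤
      ∑ a ∈ s, ‖∑ c, A t a c * y c‖ + (∑ a ∈ s, ∑ c, ‖A t a c - A₀ a c‖) * ‖y‖ := by
    rw [Finset.sum_mul, ← Finset.sum_add_distrib]
    refine Finset.sum_le_sum fun a _ => ?_
    have : ∑ c, A₀ a c * y c = ∑ c, A t a c * y c - ∑ c, (A t a c - A₀ a c) * y c := by
      rw [← Finset.sum_sub_distrib]
      exact Finset.sum_congr rfl fun c _ => by ring
    rw [this]
    refine (norm_sub_le _ _).trans (add_le_add le_rfl ?_)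
    rw [Finset.sum_mul]
    refine norm_sum_le_of_le _ fun c _ => ?_
    rw [norm_mul]
    exact mul_le_mul_of_nonneg_left (norm_le_pi_norm y c) (norm_nonneg _)
  have h2 := (hLip y).trans (mul_le_mul_of_nonneg_left h1 hK'.le)
  have h3 : K * ((∑ a ∈ s, ∑ c, ‖A t a c - A₀ a c‖) * ‖y‖) ≤ ‖y‖ / 2 := by
    have : K * ((∑ a ∈ s, ∑ c, ‖A t a c - A₀ a c‖) * ‖y‖) ≤ K * (1 / (2 * K) * ‖y‖) := by
      gcongr
    refine this.trans (le_of_eq ?_)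
    field_simp
  rw [mul_add] at h2
  linarith

/-- Stability of linear least squares problems with consistent limit. -/
theorem near_of_leastSquares (hd : Tendsto d l (𝓝 0)) (s : Finset ι) {A : T → ι → κ → ℂ}
    {A₀ : ι → κ → ℂ} {b : T → ι → ℂ} {b₀ : ι → ℂ} {x : T → κ → ℂ} {x₀ : κ → ℂ}
    (hA : ∀ a ∈ s, ∀ c, Near l d (fun t => A t a c) (A₀ a c))
    (hb : ∀ a ∈ s, Near l d (fun t => b t a) (b₀ a))
    (hinj : ∀ y : κ → ℂ, (∀ a ∈ s, ∑ c, A₀ a c * y c = 0) → y = 0)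
    (hx₀ : ∀ a ∈ s, ∑ c, A₀ a c * x₀ c = b₀ a)
    (hmin : ∀ᶠ t in l, ∑ a ∈ s, ‖b t a - ∑ c, A t a c * x t c‖ ^ 2 ≤
      ∑ a ∈ s, ‖b t a - ∑ c, A t a c * x₀ c‖ ^ 2) (c : κ) :
    Near l d (fun t => x t c) (x₀ c) := by
  obtain ⟨K, hK, hlow⟩ := exists_lower_bound hd s hA hinj
  -- The residual of the limit solution `x₀` in the perturbed problem is `O(d)` because `A₀ x₀ =
  -- b₀`. Comparison with `x₀` bounds the residual of `x` by it, and `A (x - x₀)` is the difference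
  -- of the two residuals.
  set e : T → ℝ := fun t => ∑ a ∈ s, ‖b t a - ∑ c, A t a c * x₀ c‖ with he
  have he_big : e =O[l] d := by
    have h : ∀ a ∈ s, (fun t => ‖b t a - ∑ c, A t a c * x₀ c‖) =O[l] d := by
      intro a ha
      have h1 := (hb a ha).add (Near.mul hd (Near.const (-1)) (Near.sum Finset.univ fun c _ =>
        (hA a ha c).mul hd (Near.const (x₀ c))))
      rw [hx₀ a ha] at h1
      refine IsBigO.norm_left (IsBigO.congr_left h1 fun t => ?_)
      ring
    exact IsBigO.fun_sum h
  have hbound : ∀ᶠ t in l, ‖x t c - x₀ c‖ ≤ K * (2 * s.card + 1) * ‖e t‖ := by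
    filter_upwards [hlow, hmin] with t h1 h2
    have he0 : 0 ≤ e t := Finset.sum_nonneg fun _ _ => norm_nonneg _
    have h3 := h1 (x t - x₀)
    have hres : ∀ a ∈ s, ‖b t a - ∑ c, A t a c * x t c‖ ≤ e t := by
      intro a ha
      refine le_of_sq_le_sq ?_ he0
      calc ‖b t a - ∑ c, A t a c * x t c‖ ^ 2
          ≤ ∑ a ∈ s, ‖b t a - ∑ c, A t a c * x t c‖ ^ 2 :=
            Finset.single_le_sum (f := fun a => ‖b t a - ∑ c, A t a c * x t c‖ ^ 2)
              (fun _ _ => sq_nonneg _) ha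
        _ ≤ _ := h2
        _ ≤ e t ^ 2 := Finset.sum_sq_le_sq_sum_of_nonneg fun _ _ => norm_nonneg _
    have h4 : ∑ a ∈ s, ‖∑ c, A t a c * (x t - x₀) c‖ ≤ s.card * e t + e t := by
      calc ∑ a ∈ s, ‖∑ c, A t a c * (x t - x₀) c‖
          ≤ ∑ a ∈ s, (e t + ‖b t a - ∑ c, A t a c * x₀ c‖) := by
            refine Finset.sum_le_sum fun a ha => ?_
            have : ∑ c, A t a c * (x t - x₀) c =
                (b t a - ∑ c, A t a c * x₀ c) - (b t a - ∑ c, A t a c * x t c) := by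
              simp only [Pi.sub_apply, mul_sub, Finset.sum_sub_distrib]
              ring
            rw [this]
            refine (norm_sub_le _ _).trans ?_
            rw [add_comm]
            exact add_le_add (hres a ha) le_rfl
        _ = s.card * e t + e t := by
            rw [Finset.sum_add_distrib, Finset.sum_const, nsmul_eq_mul]
    rw [Real.norm_of_nonneg he0]
    calc ‖x t c - x₀ c‖ ≤ ‖x t - x₀‖ := norm_le_pi_norm (x t - x₀) c
      _ ≤ K * (s.card * e t + e t) := h3.trans (by gcongr)
      _ ≤ K * (2 * s.card + 1) * e t := by
        have : (0 : ℝ) ≤ s.card * e t := by positivity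
        nlinarith
  exact (IsBigO.of_bound _ hbound).trans he_big

/-- The special case of consistent systems. -/
theorem near_of_solves (hd : Tendsto d l (𝓝 0)) (s : Finset ι) {A : T → ι → κ → ℂ}
    {A₀ : ι → κ → ℂ} {b : T → ι → ℂ} {b₀ : ι → ℂ} {x : T → κ → ℂ} {x₀ : κ → ℂ}
    (hA : ∀ a ∈ s, ∀ c, Near l d (fun t => A t a c) (A₀ a c))
    (hb : ∀ a ∈ s, Near l d (fun t => b t a) (b₀ a))
    (hinj : ∀ y : κ → ℂ, (∀ a ∈ s, ∑ c, A₀ a c * y c = 0) → y = 0)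
    (hx₀ : ∀ a ∈ s, ∑ c, A₀ a c * x₀ c = b₀ a)
    (hx : ∀ᶠ t in l, ∀ a ∈ s, ∑ c, A t a c * x t c = b t a) (c : κ) :
    Near l d (fun t => x t c) (x₀ c) := by
  refine near_of_leastSquares hd s hA hb hinj hx₀ ?_ c
  filter_upwards [hx] with t ht
  rw [Finset.sum_eq_zero fun a ha => by rw [ht a ha]; simp]
  positivity

/-- Linear least squares problems have solutions. -/
theorem exists_leastSquares {X : Type*} [AddCommGroup X] [Module ℂ X]
    [Finite ι] (L : X →ₗ[ℂ] (ι → ℂ)) (s : Finset ι) (b : ι → ℂ) :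
    ∃ x, IsMinOn (fun x => ∑ a ∈ s, ‖b a - L x a‖ ^ 2) Set.univ x := by
  classical
  let R : (ι → ℂ) →ₗ[ℂ] EuclideanSpace ℂ ↥s :=
    { toFun := fun y => WithLp.toLp 2 fun a => y a.1
      map_add' := fun _ _ => rfl
      map_smul' := fun _ _ => rfl }
  have hnorm : ∀ x, ∑ a ∈ s, ‖b a - L x a‖ ^ 2 = ‖R b - (R ∘ₗ L) x‖ ^ 2 := by
    intro x
    rw [EuclideanSpace.norm_sq_eq, ← Finset.sum_coe_sort s]
    rfl
  -- The range is finite-dimensional, hence complete, even if `X` is not; it therefore contains a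
  -- point nearest to `R b`.
  let V := LinearMap.range (R ∘ₗ L)
  obtain ⟨v, hv, hmin⟩ := V.exists_norm_eq_iInf_of_complete_subspace
    (completeSpace_coe_iff_isComplete.mp (FiniteDimensional.complete ℂ V)) (R b)
  obtain ⟨x, rfl⟩ := hv
  refine ⟨x, fun y _ => ?_⟩
  simp only [Set.mem_ofPred_eq, hnorm]
  rw [hmin]
  have hbdd : BddBelow (Set.range fun w : V => ‖R b - w‖) :=
    ⟨0, by rintro _ ⟨w, rfl⟩; exact norm_nonneg _⟩
  gcongr
  · exact Real.iInf_nonneg fun _ => norm_nonneg _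
  · exact ciInf_le hbdd ⟨(R ∘ₗ L) y, LinearMap.mem_range_self _ y⟩

end LeastSquares

/-! ### Eigenvectors of perturbations of a matrix with simple spectrum -/

theorem linearIndependent_ofLp {κ ι : Type*} {z : κ → EuclideanSpace ℂ ι} (hz : LinearIndependent ℂ z) :
    LinearIndependent ℂ fun i => (z i).ofLp :=
  hz.map' (WithLp.linearEquiv 2 ℂ (ι → ℂ)).toLinearMap
    (LinearMap.ker_eq_bot.mpr (WithLp.linearEquiv 2 ℂ (ι → ℂ)).injective)

section Eigenvectors

variable {T : Type*} {l : Filter T} {d : T → ℝ} {ι : Type*} [Fintype ι] {r : ℕ}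

/-- The basis formed by a linearly independent family of the right size. -/
def basisOfCard (hι : Fintype.card ι = r) {v : Fin r → ι → ℂ} (hv : LinearIndependent ℂ v) :
    Module.Basis (Fin r) ℂ (ι → ℂ) :=
  Module.Basis.mk hv (hv.span_eq_top_of_card_eq_finrank' (by simp [hι])).ge

theorem basisOfCard_apply (hι : Fintype.card ι = r) {v : Fin r → ι → ℂ}
    (hv : LinearIndependent ℂ v) (i : Fin r) : basisOfCard hι hv i = v i := by
  simp [basisOfCard]

/-- Rayleigh quotients at unit vectors near an eigenline approximate the eigenvalue. -/
theorem near_rayleigh {N : T → Matrix ι ι ℂ} {N₀ : Matrix ι ι ℂ}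
    (hN : ∀ ν β, Near l d (fun t => N t ν β) (N₀ ν β)) {v : ι → ℂ} {w : ℂ}
    (hw : N₀.mulVec v = w • v) {z : T → EuclideanSpace ℂ ι} (hz1 : ∀ᶠ t in l, ‖z t‖ = 1)
    {c : T → ℂ} (hzv : ∀ ν, (fun t => z t ν - c t * v ν) =O[l] d) :
    Near l d (fun t => dotProduct (star (z t).ofLp) ((N t).mulVec (z t).ofLp)) w := by
  have hzO : ∀ ν, (fun t => (z t).ofLp ν) =O[l] fun _ => (1 : ℝ) := fun ν =>
    IsBigO.of_bound 1 (by
      filter_upwards [hz1] with t ht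
      have := PiLp.norm_apply_le (z t) ν
      rw [ht] at this
      simpa using this)
  -- Since `N₀ v = w v`, the residual `N z - w z` equals `(N - N₀) z + (N₀ - w) (z - c v)`, and both
  -- terms are `O(d)`. Pairing it with the unit vector `z` gives the claim, with no condition on
  -- `c`.
  have hres : ∀ ν, (fun t => ((N t).mulVec (z t).ofLp) ν - w * z t ν) =O[l] d := by
    intro ν
    have h1 : ∀ β ∈ Finset.univ, (fun t => (N t ν β - N₀ ν β) * z t β +
        N₀ ν β * (z t β - c t * v β)) =O[l] d := fun β _ => by
      refine IsBigO.add ?_ ((hzv β).const_mul_left _)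
      simpa using IsBigO.mul (hN ν β) (hzO β)
    refine ((IsBigO.fun_sum h1).sub ((hzv ν).const_mul_left w)).congr_left fun t => ?_
    have h2 : ∑ β, N₀ ν β * v β = w * v ν := congrFun hw ν
    have h3 : ∑ β, ((N t ν β - N₀ ν β) * z t β + N₀ ν β * (z t β - c t * v β)) =
        ∑ β, N t ν β * z t β - c t * ∑ β, N₀ ν β * v β := by
      rw [Finset.mul_sum, ← Finset.sum_sub_distrib]
      exact Finset.sum_congr rfl fun β _ => by ring
    rw [h3, h2]
    simp only [Matrix.mulVec, dotProduct]
    ring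
  have h1 : ∀ ν ∈ Finset.univ, (fun t => star ((z t).ofLp ν) *
      (((N t).mulVec (z t).ofLp) ν - w * z t ν)) =O[l] d := fun ν _ => by
    have h2 : (fun t => star ((z t).ofLp ν)) =O[l] fun _ => (1 : ℝ) :=
      (hzO ν).norm_left.congr_left (fun t => (norm_star _).symm) |>.of_norm_left
    simpa using h2.mul (hres ν)
  refine (IsBigO.fun_sum h1).congr' ?_ EventuallyEq.rfl
  filter_upwards [hz1] with t ht
  have h2 : ∑ ν, star ((z t).ofLp ν) * z t ν = 1 := by
    have h3 := EuclideanSpace.norm_sq_eq (z t)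
    rw [ht] at h3
    have h4 : ∀ ν, star ((z t).ofLp ν) * z t ν = ((‖z t ν‖ ^ 2 : ℝ) : ℂ) := fun ν => by
      rw [← Complex.normSq_eq_norm_sq, Complex.normSq_eq_conj_mul_self]
      rfl
    rw [Finset.sum_congr rfl fun ν _ => h4 ν, ← Complex.ofReal_sum, ← h3]
    norm_num
  simp only [mul_sub, Finset.sum_sub_distrib]
  have h3 : ∑ ν, star ((z t).ofLp ν) * (w * z t ν) = w := by
    calc _ = w * ∑ ν, star ((z t).ofLp ν) * z t ν := by
          rw [Finset.mul_sum]
          exact Finset.sum_congr rfl fun ν _ => by ring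
      _ = w := by rw [h2, mul_one]
  rw [h3]
  rfl

variable [DecidableEq ι]

/-- In the basis of eigenvectors the matrix is diagonal. The `e i` may coincide, so they are found
as roots with the right multiplicities. -/
theorem charpoly_eq_prod_of_eigenvectors (hι : Fintype.card ι = r) {M : Matrix ι ι ℂ}
    {v : Fin r → ι → ℂ} (hv : LinearIndependent ℂ v) {e : Fin r → ℂ}
    (he : ∀ i, M.mulVec (v i) = e i • v i) :
    M.charpoly = ∏ i, (Polynomial.X - Polynomial.C (e i)) := by
  set b := basisOfCard hι hv
  have h1 : LinearMap.toMatrix b b (Matrix.toLin' M) = Matrix.diagonal e := by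
    ext i j
    rw [LinearMap.toMatrix_apply, basisOfCard_apply, Matrix.toLin'_apply, he, map_smul,
      ← basisOfCard_apply hι hv, Module.Basis.repr_self, Matrix.diagonal_apply]
    by_cases h : i = j
    · subst h; simp
    · simp [h]
  rw [← Matrix.charpoly_diagonal, ← h1, LinearMap.charpoly_toMatrix, Matrix.charpoly_toLin']

/-- A product of `r` distances below `g ^ r` has a factor below `g`, and the `2 * g` separation
makes the choice of that factor injective. With the `e j` as roots of a characteristic polynomial,
this matches the perturbed eigenvalues with the limiting ones. -/
theorem exists_perm_of_prod_lt {δ e : Fin r → ℂ} {g : ℝ} (hg : 0 < g)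
    (hgap : ∀ i j, i ≠ j → 2 * g ≤ ‖δ i - δ j‖) (h : ∀ i, ‖∏ j, (δ i - e j)‖ < g ^ r) :
    ∃ σ : Equiv.Perm (Fin r), ∀ i, ‖δ i - e (σ i)‖ < g := by
  have h1 : ∀ i, ∃ j, ‖δ i - e j‖ < g := by
    intro i
    by_contra! hcon
    refine (h i).not_ge ?_
    rw [norm_prod]
    calc g ^ r = ∏ _j : Fin r, g := by simp
      _ ≤ _ := Finset.prod_le_prod (fun _ _ => hg.le) fun j _ => hcon j
  choose f hf using h1
  have hinj : Function.Injective f := by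
    intro i j hij
    by_contra hne
    have h2 := hgap i j hne
    have h3 : δ i - δ j = (δ i - e (f i)) - (δ j - e (f j)) := by rw [hij]; ring
    have h4 := norm_sub_le (δ i - e (f i)) (δ j - e (f j))
    rw [← h3] at h4
    linarith [hf i, hf j]
  exact ⟨Equiv.ofBijective f (Finite.injective_iff_bijective.mp hinj), hf⟩

theorem exists_gap {δ : Fin r → ℂ} (hδ : Function.Injective δ) :
    ∃ g : ℝ, 0 < g ∧ ∀ i j, i ≠ j → 2 * g ≤ ‖δ i - δ j‖ := by
  have h : ∀ᶠ g : ℝ in 𝓝[>] 0, ∀ i j, i ≠ j → 2 * g ≤ ‖δ i - δ j‖ := by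
    refine eventually_all.mpr fun i => eventually_all.mpr fun j => ?_
    by_cases hij : i = j
    · simp [hij]
    have hpos : 0 < ‖δ i - δ j‖ / 2 := by
      have := norm_pos_iff.mpr (sub_ne_zero.mpr (hδ.ne hij))
      positivity
    filter_upwards [mem_nhdsWithin_of_mem_nhds (gt_mem_nhds hpos)] with g hg _
    have : g < ‖δ i - δ j‖ / 2 := hg
    linarith
  obtain ⟨g, hg, hpos⟩ := (h.and self_mem_nhdsWithin).exists
  exact ⟨g, hpos, hg⟩

/-- Each `δ i` is a root of the limit characteristic polynomial, and the determinant is continuous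
in the matrix. -/
theorem eventually_charpoly_small (hι : Fintype.card ι = r) (hd : Tendsto d l (𝓝 0))
    {M : T → Matrix ι ι ℂ} {M₀ : Matrix ι ι ℂ}
    (hM : ∀ ν β, Near l d (fun t => M t ν β) (M₀ ν β)) {v : Fin r → ι → ℂ}
    (hv : LinearIndependent ℂ v) {δ : Fin r → ℂ} (hδ : ∀ i, M₀.mulVec (v i) = δ i • v i)
    {ε : ℝ} (hε : 0 < ε) : ∀ᶠ t in l, ∀ i, ‖(M t).charpoly.eval (δ i)‖ < ε := by
  refine eventually_all.mpr fun i => ?_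
  have h1 : Tendsto M l (𝓝 M₀) :=
    tendsto_pi_nhds.mpr fun ν => tendsto_pi_nhds.mpr fun β => (hM ν β).tendsto hd
  have h2 : Continuous fun N : Matrix ι ι ℂ => (Matrix.scalar ι (δ i) - N).det :=
    (continuous_const.sub continuous_id).matrix_det
  have h3 := ((h2.tendsto M₀).comp h1).norm
  have h4 : (Matrix.scalar ι (δ i) - M₀).det = 0 := by
    rw [← Matrix.eval_charpoly, charpoly_eq_prod_of_eigenvectors hι hv hδ,
      Polynomial.eval_prod]
    exact Finset.prod_eq_zero (Finset.mem_univ i) (by simp)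
  rw [h4, norm_zero] at h3
  filter_upwards [h3.eventually (gt_mem_nhds hε)] with t ht
  rwa [Matrix.eval_charpoly]

/-- A small perturbation of a matrix with simple spectrum has a full system of unit
eigenvectors. -/
theorem eventually_exists_eigenvectors (hι : Fintype.card ι = r) (hd : Tendsto d l (𝓝 0))
    {M : T → Matrix ι ι ℂ} {M₀ : Matrix ι ι ℂ}
    (hM : ∀ ν β, Near l d (fun t => M t ν β) (M₀ ν β)) {v : Fin r → ι → ℂ}
    (hv : LinearIndependent ℂ v) {δ : Fin r → ℂ} (hδ : ∀ i, M₀.mulVec (v i) = δ i • v i)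
    (hinj : Function.Injective δ) :
    ∀ᶠ t in l, ∃ (z : Fin r → EuclideanSpace ℂ ι) (e : Fin r → ℂ), (∀ i, ‖z i‖ = 1) ∧
      (∀ i, (M t).mulVec (z i).ofLp = e i • (z i).ofLp) ∧ LinearIndependent ℂ z := by
  obtain ⟨g, hg, hgap⟩ := exists_gap hinj
  filter_upwards [eventually_charpoly_small hι hd hM hv hδ (pow_pos hg r)] with t ht
  have hcard : (M t).charpoly.roots.card = r := by
    rw [← (IsAlgClosed.splits (M t).charpoly).natDegree_eq_card_roots,
      Matrix.charpoly_natDegree_eq_dim, hι]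
  obtain ⟨L, hL⟩ : ∃ L : List ℂ, (L : Multiset ℂ) = (M t).charpoly.roots :=
    ⟨_, Multiset.coe_toList _⟩
  have hlen : L.length = r := by rw [← hcard, ← hL, Multiset.coe_card]
  subst hlen
  have hprod : (M t).charpoly = ∏ j : Fin L.length, (Polynomial.X - Polynomial.C (L.get j)) := by
    have h1 := (IsAlgClosed.splits (M t).charpoly).eq_prod_roots_of_monic
      (Matrix.charpoly_monic _)
    rw [h1, ← hL, Multiset.map_coe, Multiset.prod_coe, ← List.prod_ofFn]
    congr 1
    conv_lhs => rw [← List.ofFn_get L, List.map_ofFn]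
    rfl
  obtain ⟨σ, hσ⟩ := exists_perm_of_prod_lt (e := L.get) hg hgap fun i => by
    have := ht i
    rw [hprod, Polynomial.eval_prod] at this
    simpa using this
  -- Perturbed eigenvalues within `g` of points that are `2 * g` apart are distinct, so eigenvectors
  -- for them are independent.
  have he_inj : Function.Injective (fun i => L.get (σ i)) := by
    intro i j hij
    by_contra hne
    have h2 := hgap i j hne
    have h3 : δ i - δ j = (δ i - L.get (σ i)) - (δ j - L.get (σ j)) := by
      have : L.get (σ i) = L.get (σ j) := hij
      rw [this]; ring
    have h4 := norm_sub_le (δ i - L.get (σ i)) (δ j - L.get (σ j))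
    rw [← h3] at h4
    linarith [hσ i, hσ j]
  have hev : ∀ i, ∃ z : EuclideanSpace ℂ ι, ‖z‖ = 1 ∧
      (M t).mulVec z.ofLp = L.get (σ i) • z.ofLp := by
    intro i
    have hroot : (Matrix.toLin' (M t)).charpoly.IsRoot (L.get (σ i)) := by
      rw [Matrix.charpoly_toLin', hprod, Polynomial.IsRoot, Polynomial.eval_prod]
      exact Finset.prod_eq_zero (Finset.mem_univ (σ i)) (by simp)
    obtain ⟨x, hx⟩ := ((Module.End.hasEigenvalue_iff_isRoot_charpoly _ _).mpr
      hroot).exists_hasEigenvector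
    have hx0 : WithLp.toLp 2 x ≠ (0 : EuclideanSpace ℂ ι) := fun h =>
      hx.2 (by simpa using congrArg WithLp.ofLp h)
    have hxe : (M t).mulVec x = L.get (σ i) • x := by
      simpa using hx.apply_eq_smul
    refine ⟨((‖(WithLp.toLp 2 x : EuclideanSpace ℂ ι)‖⁻¹ : ℝ) : ℂ) • WithLp.toLp 2 x, ?_, ?_⟩
    · rw [norm_smul, Complex.norm_real, norm_inv, norm_norm]
      exact inv_mul_cancel₀ (norm_ne_zero_iff.mpr hx0)
    · rw [WithLp.ofLp_smul, Matrix.mulVec_smul, hxe, smul_comm]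
  choose z hz1 hz2 using hev
  refine ⟨z, fun i => L.get (σ i), hz1, hz2, ?_⟩
  have hli : LinearIndependent ℂ fun i => (z i).ofLp := by
    refine Module.End.eigenvectors_linearIndependent' (Matrix.toLin' (M t)) _ he_inj _
      fun i => ⟨?_, fun h => ?_⟩
    · rw [Module.End.mem_eigenspace_iff, Matrix.toLin'_apply, hz2]
    · have h0 : z i = 0 := by
        ext ν
        exact congrFun h ν
      have := hz1 i
      rw [h0, norm_zero] at this
      exact zero_ne_one this
  exact hli.map' (WithLp.linearEquiv 2 ℂ (ι → ℂ)).symm.toLinearMap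
    (LinearMap.ker_eq_bot.mpr (WithLp.linearEquiv 2 ℂ (ι → ℂ)).symm.injective)

/-- The unit eigenvectors of a small perturbation of a matrix with simple spectrum are, after a
permutation, near the eigenlines of the limit. -/
theorem exists_perm_eigenvectors_near (hι : Fintype.card ι = r) (hd : Tendsto d l (𝓝 0))
    {M : T → Matrix ι ι ℂ} {M₀ : Matrix ι ι ℂ}
    (hM : ∀ ν β, Near l d (fun t => M t ν β) (M₀ ν β)) {v : Fin r → ι → ℂ}
    (hv : LinearIndependent ℂ v) {δ : Fin r → ℂ} (hδ : ∀ i, M₀.mulVec (v i) = δ i • v i)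
    (hinj : Function.Injective δ) {z : T → Fin r → EuclideanSpace ℂ ι} {e : T → Fin r → ℂ}
    (hz1 : ∀ᶠ t in l, ∀ i, ‖z t i‖ = 1)
    (hze : ∀ᶠ t in l, ∀ i, (M t).mulVec (z t i).ofLp = e t i • (z t i).ofLp)
    (hzl : ∀ᶠ t in l, LinearIndependent ℂ (z t)) :
    ∃ σ : T → Equiv.Perm (Fin r), ∀ i, ∃ c : T → ℂ, ∀ ν,
      (fun t => z t (σ t i) ν - c t * v i ν) =O[l] d := by
  classical
  obtain ⟨g, hg, hgap⟩ := exists_gap hinj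
  have hσ : ∀ᶠ t in l, ∃ σ : Equiv.Perm (Fin r), ∀ i, ‖δ i - e t (σ i)‖ < g := by
    filter_upwards [eventually_charpoly_small hι hd hM hv hδ (pow_pos hg r), hze, hzl]
      with t h1 h2 h3
    refine exists_perm_of_prod_lt hg hgap fun i => ?_
    have h4 := h1 i
    rw [charpoly_eq_prod_of_eigenvectors hι (linearIndependent_ofLp h3) h2,
      Polynomial.eval_prod] at h4
    simpa using h4
  -- The identity is a default value for those `t` at which the eigenvalues cannot be matched;
  -- eventually there are none.
  let σ : T → Equiv.Perm (Fin r) := fun t =>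
    if h : ∃ σ : Equiv.Perm (Fin r), ∀ i, ‖δ i - e t (σ i)‖ < g then h.choose else 1
  have hσ' : ∀ᶠ t in l, ∀ i, ‖δ i - e t (σ t i)‖ < g := by
    filter_upwards [hσ] with t ht
    simp only [σ, dif_pos ht]
    exact ht.choose_spec
  refine ⟨σ, fun i => ?_⟩
  set b := basisOfCard hι hv with hb
  have hbv : ∀ j, b j = v j := basisOfCard_apply hι hv
  have hrepr : ∀ (x : ι → ℂ) j, b.repr x j = ∑ ν, x ν * b.repr (Pi.single ν 1) j := by
    intro x j
    conv_lhs => rw [pi_eq_sum_univ' x]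
    simp [map_sum, Finsupp.finsetSum_apply]
  have hdiag : ∀ (x : ι → ℂ) j, b.repr (M₀.mulVec x) j = δ j * b.repr x j := by
    intro x j
    conv_lhs => rw [← b.sum_repr x]
    simp only [Matrix.mulVec_sum, Matrix.mulVec_smul, hbv, hδ]
    simp only [← hbv, map_sum, map_smul, Module.Basis.repr_self, Finsupp.finsetSum_apply,
      Finsupp.smul_apply, Finsupp.single_apply, smul_eq_mul]
    simp [mul_comm]
  have hbd : ∀ᶠ t in l, ∀ j ν, ‖(z t j).ofLp ν‖ ≤ 1 := by
    filter_upwards [hz1] with t ht j ν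
    rw [← ht j]
    exact PiLp.norm_apply_le (z t j) ν
  have hzO : ∀ ν, (fun t => (z t (σ t i)).ofLp ν) =O[l] fun _ => (1 : ℝ) := fun ν =>
    IsBigO.of_bound 1 (by filter_upwards [hbd] with t ht; simpa using ht _ ν)
  have hdiff : ∀ ν, (fun t => ((M₀ - M t).mulVec (z t (σ t i)).ofLp) ν) =O[l] d := by
    intro ν
    have h : ∀ β ∈ Finset.univ,
        (fun t => (M₀ - M t) ν β * (z t (σ t i)).ofLp β) =O[l] d := by
      intro β _
      have h1 : (fun t => (M₀ - M t) ν β) =O[l] d := by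
        refine (IsBigO.neg_left (hM ν β)).congr_left fun t => ?_
        simp
      simpa using h1.mul (hzO β)
    exact IsBigO.fun_sum h
  -- The `j`-th coordinate of `(M₀ - M) z` in the limit eigenbasis is `(δ j - e)` times that of `z`.
  -- For `j ≠ i` the factor is at least `g` in norm, as `e` is within `g` of `δ i`, so the
  -- coordinate is `O(d)`. Only the `i`-th coordinate, which becomes `c`, can be large.
  have hcoord : ∀ j, j ≠ i → (fun t => b.repr (z t (σ t i)).ofLp j) =O[l] d := by
    intro j hj
    have h1 : (fun t => b.repr ((M₀ - M t).mulVec (z t (σ t i)).ofLp) j) =O[l] d := by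
      have h : ∀ ν ∈ Finset.univ, (fun t => ((M₀ - M t).mulVec (z t (σ t i)).ofLp) ν *
          b.repr (Pi.single ν 1) j) =O[l] d := fun ν _ => by
        simpa [mul_comm] using (hdiff ν).const_mul_left (b.repr (Pi.single ν 1) j)
      refine (IsBigO.fun_sum h).congr_left fun t => ?_
      rw [hrepr]
    refine IsBigO.trans (IsBigO.of_bound g⁻¹ ?_) h1
    filter_upwards [hze, hσ'] with t h2 h3
    rw [Matrix.sub_mulVec, h2, map_sub, Finsupp.sub_apply, hdiag, map_smul,
      Finsupp.smul_apply, smul_eq_mul, ← sub_mul, norm_mul, ← mul_assoc]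
    have h4 : g ≤ ‖δ j - e t (σ t i)‖ := by
      have h5 := hgap i j hj.symm
      have h6 : δ i - δ j = (δ i - e t (σ t i)) - (δ j - e t (σ t i)) := by ring
      have h7 := norm_sub_le (δ i - e t (σ t i)) (δ j - e t (σ t i))
      rw [← h6] at h7
      linarith [h3 i]
    have h8 : 1 ≤ g⁻¹ * ‖δ j - e t (σ t i)‖ := by
      rw [inv_mul_eq_div, le_div_iff₀ hg]
      linarith
    nlinarith [norm_nonneg (b.repr (z t (σ t i)).ofLp j)]
  refine ⟨fun t => b.repr (z t (σ t i)).ofLp i, fun ν => ?_⟩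
  have h : ∀ j ∈ Finset.univ.erase i,
      (fun t => b.repr (z t (σ t i)).ofLp j * v j ν) =O[l] d := fun j hj => by
    simpa [mul_comm] using (hcoord j (Finset.ne_of_mem_erase hj)).const_mul_left (v j ν)
  refine (IsBigO.fun_sum h).congr_left fun t => ?_
  have h1 := congrFun (b.sum_repr (z t (σ t i)).ofLp) ν
  rw [← Finset.add_sum_erase _ _ (Finset.mem_univ i)] at h1
  simp only [Pi.add_apply, Finset.sum_apply, Pi.smul_apply, smul_eq_mul, hbv] at h1
  rw [← h1]
  ring

end Eigenvectors

/-! ### Independence of rows and solvability of square systems -/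

section SquareSystems

variable {ι : Type*} [Fintype ι] {r : ℕ}

theorem exists_solution_of_linearIndependent {v : Fin r → ι → ℂ}
    (hv : LinearIndependent ℂ v) (y : Fin r → ℂ) : ∃ g : ι → ℂ, ∀ i, ∑ β, v i β * g β = y i := by
  have h1 : (Matrix.of v).rank = Fintype.card (Fin r) :=
    LinearIndependent.rank_matrix (M := Matrix.of v) hv
  have h2 : LinearMap.range (Matrix.of v).mulVecLin = ⊤ := by
    refine Submodule.eq_top_of_finrank_eq ?_
    rw [← Matrix.rank, h1]
    simp
  obtain ⟨g, hg⟩ := LinearMap.range_eq_top.mp h2 y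
  exact ⟨g, fun i => congrFun hg i⟩

theorem surjective_iff_injective_square (hι : Fintype.card ι = r) (v : Fin r → ι → ℂ) :
    (∀ y : Fin r → ℂ, ∃ g : ι → ℂ, ∀ i, ∑ β, v i β * g β = y i) ↔
      ∀ g : ι → ℂ, (∀ i, ∑ β, v i β * g β = 0) → g = 0 := by
  have h := LinearMap.injective_iff_surjective_of_finrank_eq_finrank
    (f := (Matrix.of v).mulVecLin) (by simp [hι])
  rw [← LinearMap.ker_eq_bot, LinearMap.ker_eq_bot'] at h
  constructor
  · intro hs g hg
    refine h.mpr (fun y => ?_) g (funext hg)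
    obtain ⟨g, hg⟩ := hs y
    exact ⟨g, funext hg⟩
  · intro hi y
    obtain ⟨g, hg⟩ := h.mp (fun g hg => hi g fun i => congrFun hg i) y
    exact ⟨g, fun i => congrFun hg i⟩

theorem linearIndependent_of_surjective {v : Fin r → ι → ℂ}
    (h : ∀ y : Fin r → ℂ, ∃ g : ι → ℂ, ∀ i, ∑ β, v i β * g β = y i) :
    LinearIndependent ℂ v := by
  rw [Fintype.linearIndependent_iff]
  intro c hc i
  obtain ⟨g, hg⟩ := h (Pi.single i 1)
  have h1 : ∑ j, c j * ∑ β, v j β * g β = 0 := by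
    have h2 : ∀ β, ∑ j, c j * v j β = 0 := fun β => by simpa using congrFun hc β
    calc ∑ j, c j * ∑ β, v j β * g β = ∑ β, (∑ j, c j * v j β) * g β := by
          simp only [Finset.mul_sum, Finset.sum_mul]
          rw [Finset.sum_comm]
          simp only [mul_assoc]
      _ = 0 := by simp [h2]
  simpa [hg, Pi.single_apply] using h1

theorem eq_zero_of_linearIndependent {κ : Type*} {v : Fin r → κ → ℂ}
    (hv : LinearIndependent ℂ v) {y : Fin r → ℂ} (h : ∀ a, ∑ i, y i * v i a = 0) : y = 0 := by
  have h1 := Fintype.linearIndependent_iff.mp hv y (by ext a; simpa using h a)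
  exact funext h1

end SquareSystems

/-! ### Squarefree monomials, their labels and the entries of sums of powers -/

section Monomials

variable {m n k p r : ℕ}

theorem tensorPower_label (x : Vec n) {S : Finset (Fin (n + 1))} (h : S.card ≤ m) :
    tensorPower m x (label m S) = x 0 ^ (m - S.card) * evalMono x S := by
  obtain ⟨e, rfl⟩ := Nat.exists_eq_add_of_le h
  rw [tensorPower, Fin.prod_univ_add]
  have h1 : ∏ i : Fin S.card, x (label (S.card + e) S (Fin.castAdd e i)) = evalMono x S := by
    rw [evalMono, ← Finset.prod_coe_sort S]
    refine Fintype.prod_equiv (S.orderIsoOfFin rfl).toEquiv _ _ fun i => ?_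
    simp [label]
  rw [h1]
  simp [label, mul_comm]

/-- Distinct entries leave room for a single padding zero, so the degree must be at least `m - 1`.
Only such entries are controlled by the perturbation bound. -/
theorem label_mem_Omega {S : Finset (Fin (n + 1))} (h0 : 0 ∉ S) (h1 : m ≤ S.card + 1) :
    label m S ∈ Omega m n := by
  rw [Omega, Finset.mem_filter]
  refine ⟨Finset.mem_univ _, fun s t hst => ?_⟩
  have hmem : ∀ (s : Fin m) (h : (s : ℕ) < S.card), label m S s ∈ S := fun s h => by
    rw [label, dif_pos h]
    exact S.orderEmbOfFin_mem rfl _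
  have hzero : ∀ (s : Fin m), ¬ (s : ℕ) < S.card → label m S s = 0 := fun s h => dif_neg h
  by_cases hs : (s : ℕ) < S.card <;> by_cases ht : (t : ℕ) < S.card
  · rw [label, label, dif_pos hs, dif_pos ht] at hst
    have := (S.orderEmbOfFin rfl).injective hst
    simpa [Fin.ext_iff] using this
  · exact absurd (hzero t ht ▸ hst ▸ hmem s hs) h0
  · exact absurd (hzero s hs ▸ hst ▸ hmem t ht) h0
  · ext
    omega

theorem Precedes.trans {S T R : Finset (Fin (n + 1))} (h1 : Precedes S T) (h2 : Precedes T R) :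
    Precedes S R := by
  obtain ⟨i, hi, hi', hi2⟩ := h1
  obtain ⟨j, hj, hj', hj2⟩ := h2
  rcases lt_trichotomy i j with h | h | h
  · exact ⟨i, hi, fun hR => hi' ((hj2 i h).mpr hR), fun a ha =>
      (hi2 a ha).trans (hj2 a (ha.trans h))⟩
  · exact absurd (h ▸ hj) hi'
  · exact ⟨j, (hi2 j h).mpr hj, hj', fun a ha => (hi2 a (ha.trans h)).trans (hj2 a ha)⟩

theorem Precedes.irrefl (S : Finset (Fin (n + 1))) : ¬ Precedes S S :=
  fun ⟨_, h, h', _⟩ => h' h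

theorem precedes_total {S T : Finset (Fin (n + 1))} (h : S ≠ T) :
    Precedes S T ∨ Precedes T S := by
  have hne : (symmDiff S T).Nonempty := by
    rw [Finset.nonempty_iff_ne_empty]
    exact fun h' => h (symmDiff_eq_bot.mp h')
  have hmin : ∀ j < (symmDiff S T).min' hne, (j ∈ S ↔ j ∈ T) := by
    intro j hj
    have h1 : j ∉ symmDiff S T := fun h' => (Finset.min'_le _ _ h').not_gt hj
    rw [Finset.mem_symmDiff] at h1
    tauto
  rcases Finset.mem_symmDiff.mp (Finset.min'_mem _ hne) with ⟨h1, h2⟩ | ⟨h1, h2⟩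
  · exact Or.inl ⟨_, h1, h2, hmin⟩
  · exact Or.inr ⟨_, h1, h2, fun j hj => (hmin j hj).symm⟩

/-- Counting predecessors is strictly monotone for the total order on `J₁`, hence injective, and on
`𝓑₀` it takes values below `r`. -/
theorem card_B0_le : (B0 n k p r).card ≤ r := by
  have hlt : ∀ S ∈ J1 n k p, ∀ T, Precedes S T →
      ((J1 n k p).filter fun R => Precedes R S).card <
        ((J1 n k p).filter fun R => Precedes R T).card := by
    intro S hS T hST
    refine Finset.card_lt_card (Finset.ssubset_iff_of_subset ?_ |>.mpr
      ⟨S, Finset.mem_filter.mpr ⟨hS, hST⟩, fun h => Precedes.irrefl S (Finset.mem_filter.mp h).2⟩)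
    intro R hR
    rw [Finset.mem_filter] at hR ⊢
    exact ⟨hR.1, hR.2.trans hST⟩
  have h := Finset.card_le_card_of_injOn (s := B0 n k p r) (t := Finset.range r)
    (fun S => ((J1 n k p).filter fun R => Precedes R S).card)
    (fun S hS => Finset.mem_coe.mpr (Finset.mem_range.mpr (Finset.mem_filter.mp hS).2)) ?_
  · simpa using h
  · intro S hS T hT hST
    by_contra hne
    have hS' := (Finset.mem_filter.mp hS).1
    have hT' := (Finset.mem_filter.mp hT).1
    rcases precedes_total hne with h | h
    · exact (hlt S hS' T h).ne hST
    · exact (hlt T hT' S h).ne hST.symm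

theorem mem_J1_of_mem_B0 {S : Finset (Fin (n + 1))} (h : S ∈ B0 n k p r) : S ∈ J1 n k p :=
  (Finset.mem_filter.mp h).1

theorem mem_J1 {S : Finset (Fin (n + 1))} : S ∈ J1 n k p ↔ S ⊆ low n k ∧ S.card = p :=
  Finset.mem_powersetCard

theorem mem_J2 {S : Finset (Fin (n + 1))} :
    S ∈ J2 n m k p ↔ S ⊆ high n k ∧ S.card = m - p - 1 :=
  Finset.mem_powersetCard

theorem disjoint_low_high : Disjoint (low n k) (high n k) := by
  rw [Finset.disjoint_left]
  intro j h1 h2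
  simp only [low, high, Finset.mem_filter, Finset.mem_univ, true_and] at h1 h2
  omega

theorem zero_notMem_low : (0 : Fin (n + 1)) ∉ low n k := by simp [low]

theorem zero_notMem_high : (0 : Fin (n + 1)) ∉ high n k := by simp [high]

theorem mem_low_or_high {j : Fin (n + 1)} (h : j ≠ 0) : j ∈ low n k ∨ j ∈ high n k := by
  have : (j : ℕ) ≠ 0 := fun h' => h (Fin.ext h')
  simp only [low, high, Finset.mem_filter, Finset.mem_univ, true_and]
  omega

theorem evalMono_union {x : Fin (n + 1) → ℂ} {S T : Finset (Fin (n + 1))} (h : Disjoint S T) :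
    evalMono x (S ∪ T) = evalMono x S * evalMono x T :=
  Finset.prod_union h

theorem evalMono_insert {x : Fin (n + 1) → ℂ} {j : Fin (n + 1)} {S : Finset (Fin (n + 1))}
    (h : j ∉ S) : evalMono x (insert j S) = x j * evalMono x S :=
  Finset.prod_insert h

theorem evalMono_smul (c : ℂ) (x : Vec n) (S : Finset (Fin (n + 1))) :
    evalMono (c • x).ofLp S = c ^ S.card * evalMono x.ofLp S := by
  simp [evalMono, Finset.prod_mul_distrib]

theorem disjoint_of_low_high {S T : Finset (Fin (n + 1))} (hS : S ⊆ low n k)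
    (hT : T ⊆ high n k) : Disjoint S T :=
  disjoint_low_high.mono hS hT

theorem entry_sum (c : Fin r → ℂ) (x : Fin r → Vec n) {S : Finset (Fin (n + 1))}
    (h : S.card ≤ m) : entry (∑ i, c i • tensorPower m (x i)) S =
      ∑ i, c i * (x i 0 ^ (m - S.card) * evalMono (x i).ofLp S) := by
  simp [entry, Finset.sum_apply, tensorPower_label _ h]

/-- The entries of a sum of powers at products of a monomial in the first `k` variables and a
monomial in the last `n - k` variables. -/
theorem entry_sum_union (c : Fin r → ℂ) (x : Fin r → Vec n) {S R : Finset (Fin (n + 1))}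
    (hS : S ⊆ low n k) (hR : R ⊆ high n k) (h : S.card + R.card ≤ m) :
    entry (∑ i, c i • tensorPower m (x i)) (S ∪ R) =
      ∑ i, c i * (x i 0 ^ (m - (S.card + R.card)) *
        (evalMono (x i).ofLp S * evalMono (x i).ofLp R)) := by
  have hd := disjoint_of_low_high hS hR
  rw [entry_sum _ _ (by rw [Finset.card_union_of_disjoint hd]; exact h),
    Finset.card_union_of_disjoint hd]
  simp only [evalMono_union hd]

theorem entry_sum_union_one (c : Fin r → ℂ) {x : Fin r → Vec n} (hx : ∀ i, x i 0 = 1)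
    {S R : Finset (Fin (n + 1))} (hS : S ⊆ low n k) (hR : R ⊆ high n k)
    (h : S.card + R.card ≤ m) :
    entry (∑ i, c i • tensorPower m (x i)) (S ∪ R) =
      ∑ i, c i * evalMono (x i).ofLp S * evalMono (x i).ofLp R := by
  rw [entry_sum_union c x hS hR h]
  simp [hx, mul_assoc]

theorem label_union_mem_Omega {S R : Finset (Fin (n + 1))} (hS : S ⊆ low n k)
    (hR : R ⊆ high n k) (h : m ≤ S.card + R.card + 1) : label m (S ∪ R) ∈ Omega m n := by
  refine label_mem_Omega (fun h0 => ?_)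
    (by rwa [Finset.card_union_of_disjoint (disjoint_of_low_high hS hR)])
  rcases Finset.mem_union.mp h0 with h0 | h0
  · exact zero_notMem_low (hS h0)
  · exact zero_notMem_high (hR h0)

theorem norm_sub_le_distOmega (F F' : Tensor m n) {t : Fin m → Fin (n + 1)}
    (ht : t ∈ Omega m n) : ‖F t - F' t‖ ≤ distOmega F F' := by
  refine Real.le_sqrt_of_sq_le ?_
  exact Finset.single_le_sum (f := fun t => ‖F t - F' t‖ ^ 2) (fun _ _ => sq_nonneg _) ht

theorem distOmega_nonneg (F F' : Tensor m n) : 0 ≤ distOmega F F' := Real.sqrt_nonneg _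

theorem distOmega_comm (F F' : Tensor m n) : distOmega F F' = distOmega F' F := by
  simp [distOmega, sqDistOmega, norm_sub_rev]

theorem distOmega_triangle (F F' F'' : Tensor m n) :
    distOmega F F'' ≤ distOmega F F' + distOmega F' F'' := by
  let R : Tensor m n → EuclideanSpace ℂ ↥(Omega m n) := fun F => WithLp.toLp 2 fun t => F t.1
  have h : ∀ F F' : Tensor m n, distOmega F F' = dist (R F) (R F') := by
    intro F F'
    rw [EuclideanSpace.dist_eq, distOmega, sqDistOmega, ← Finset.sum_coe_sort (Omega m n)]
    simp [R, dist_eq_norm]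
  rw [h, h, h]
  exact dist_triangle _ _ _

theorem mem_O {α S : Finset (Fin (n + 1))} :
    S ∈ O n m k p α ↔ S ∈ J2 n m k p ∧ Disjoint S α :=
  Finset.mem_filter

end Monomials

/-! ### Generating matrices and the factorisation of `A[α, F]` -/

section GeneratingMatrix

variable {m n k p r : ℕ}

/-- The values of the monomials of `𝓑₀` at a point. -/
def monoB0 (k p r : ℕ) (x : Vec n) : ↥(B0 n k p r) → ℂ := fun β => evalMono x.ofLp β.1

/-- The columns of `G` express the monomials of `𝓑₁` by those of `𝓑₀` on the points `u i`. -/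
def IsGenerating (u : Fin r → Vec n) (G : Matrix ↥(B0 n k p r) ↥(B1 n k p) ℂ) : Prop :=
  ∀ (α : ↥(B1 n k p)) (i : Fin r), ∑ β, monoB0 k p r (u i) β * G β α = evalMono (u i).ofLp α.1

/-- Independence of `r` vectors in `ℂ^{𝓑₀}` supplies the lower bound. This makes the evaluation
matrix on `𝓑₀` square. -/
theorem card_B0_eq {x : Fin r → Vec n} (h : LinearIndependent ℂ fun i => monoB0 k p r (x i)) :
    Fintype.card ↥(B0 n k p r) = r := by
  refine le_antisymm (by simpa using card_B0_le) ?_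
  simpa using h.fintype_card_le_finrank

theorem exists_isGenerating {u : Fin r → Vec n}
    (h : LinearIndependent ℂ fun i => monoB0 k p r (u i)) :
    ∃ G : Matrix ↥(B0 n k p r) ↥(B1 n k p) ℂ, IsGenerating u G := by
  choose g hg using fun α : ↥(B1 n k p) =>
    exists_solution_of_linearIndependent h fun i => evalMono (u i).ofLp α.1
  exact ⟨fun β α => g α β, fun α i => hg α i⟩

theorem exists_eq_insert_of_mem_B1 {α : Finset (Fin (n + 1))} (h : α ∈ B1 n k p) :
    ∃ l ∈ high n k, ∃ ν ∈ J1 n k p, α = insert l ν := by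
  obtain ⟨l, hl, ν, hν, rfl⟩ := Finset.mem_image₂.mp h
  exact ⟨l, hl, ν, hν, rfl⟩

theorem notMem_of_mem_high {l : Fin (n + 1)} (hl : l ∈ high n k) {ν : Finset (Fin (n + 1))}
    (hν : ν ⊆ low n k) : l ∉ ν :=
  fun h => Finset.disjoint_left.mp disjoint_low_high (hν h) hl

/-- Row `ν` evaluates the expression of `x_l x^ν` by `𝓑₀` at `u i`. The eigenvectors do not depend
on `l`, which is why those of the single matrix `N(ξ)` reveal all the last coordinates. -/
theorem IsGenerating.matN_mulVec {u : Fin r → Vec n}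
    {G : Matrix ↥(B0 n k p r) ↥(B1 n k p) ℂ} (hG : IsGenerating u G) (i : Fin r)
    (l : ↥(high n k)) :
    (matN G l).mulVec (monoB0 k p r (u i)) = u i l.1 • monoB0 k p r (u i) := by
  ext ν
  have h := hG ⟨insert l.1 ν.1, insert_mem_B1 l.2 ν.2⟩ i
  rw [evalMono_insert (notMem_of_mem_high l.2 (mem_J1.mp (mem_J1_of_mem_B0 ν.2)).1)] at h
  simp only [Pi.smul_apply, smul_eq_mul, Matrix.mulVec, dotProduct, matN, Matrix.of_apply]
  rw [monoB0, ← h]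
  exact Finset.sum_congr rfl fun β _ => mul_comm _ _

theorem IsGenerating.matNxi_mulVec {u : Fin r → Vec n}
    {G : Matrix ↥(B0 n k p r) ↥(B1 n k p) ℂ} (hG : IsGenerating u G)
    (ξ : ↥(high n k) → ℂ) (i : Fin r) :
    (matNxi ξ G).mulVec (monoB0 k p r (u i)) =
      (∑ l, ξ l * u i l.1) • monoB0 k p r (u i) := by
  simp only [matNxi, Matrix.sum_mulVec, Matrix.smul_mulVec, hG.matN_mulVec, smul_smul,
    Finset.sum_smul]

theorem union_eq_insert_union {l : Fin (n + 1)} {ν γ : Finset (Fin (n + 1))} :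
    insert l ν ∪ γ = ν ∪ insert l γ := by
  ext j
  simp only [Finset.mem_union, Finset.mem_insert]
  tauto

theorem matA_apply (h1 : p + 1 ≤ m) (c : Fin r → ℂ) (x : Fin r → Vec n)
    (α : Finset (Fin (n + 1))) (γ : ↥(O n m k p α)) (β : ↥(B0 n k p r)) :
    matA k p r (∑ i, c i • tensorPower m (x i)) α γ β =
      ∑ i, c i * (x i 0 * (monoB0 k p r (x i) β * evalMono (x i).ofLp γ.1)) := by
  obtain ⟨hβ, hβc⟩ := mem_J1.mp (mem_J1_of_mem_B0 β.2)
  obtain ⟨hγ, hγc⟩ := mem_J2.mp (mem_O.mp γ.2).1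
  rw [matA, Matrix.of_apply, entry_sum_union c x hβ hγ (by omega), hβc, hγc]
  -- The monomial has degree `m - 1`, so one factor `x₀` is left; the entries of `b[α, F]` have full
  -- degree `m` and carry none.
  rw [show m - (p + (m - p - 1)) = 1 by omega]
  simp only [pow_one]
  rfl

/-- This is the factorisation of `A[α, F]`: evaluation on `𝓑₀`, then the diagonal of the `c i * x i
0`, then the transposed evaluation on `𝓞_α`. -/
theorem matA_mulVec_eq_sum (h1 : p + 1 ≤ m) (c : Fin r → ℂ) (x : Fin r → Vec n)
    (α : Finset (Fin (n + 1))) (γ : ↥(O n m k p α)) (y : ↥(B0 n k p r) → ℂ) :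
    ∑ β, matA k p r (∑ i, c i • tensorPower m (x i)) α γ β * y β =
      ∑ i, c i * x i 0 * (∑ β, monoB0 k p r (x i) β * y β) * evalMono (x i).ofLp γ.1 := by
  simp only [matA_apply h1, Finset.sum_mul, Finset.mul_sum]
  rw [Finset.sum_comm]
  exact Finset.sum_congr rfl fun i _ => Finset.sum_congr rfl fun β _ => by ring

theorem vecB_apply (h1 : p + 1 ≤ m) (c : Fin r → ℂ) (x : Fin r → Vec n)
    {α : Finset (Fin (n + 1))} (hα : α ∈ B1 n k p) (γ : ↥(O n m k p α)) :
    vecB k p (∑ i, c i • tensorPower m (x i)) α γ =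
      ∑ i, c i * evalMono (x i).ofLp α * evalMono (x i).ofLp γ.1 := by
  obtain ⟨l, hl, ν, hν, rfl⟩ := exists_eq_insert_of_mem_B1 hα
  obtain ⟨hνs, hνc⟩ := mem_J1.mp hν
  obtain ⟨hγJ, hγd⟩ := mem_O.mp γ.2
  obtain ⟨hγ, hγc⟩ := mem_J2.mp hγJ
  have hlγ : l ∉ γ.1 := fun h => Finset.disjoint_left.mp hγd h (Finset.mem_insert_self _ _)
  have hlν := notMem_of_mem_high hl hνs
  have hcard : ν.card + (insert l γ.1).card = m := by
    rw [Finset.card_insert_of_notMem hlγ]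
    omega
  rw [vecB, union_eq_insert_union, entry_sum_union c x hνs
    (Finset.insert_subset hl hγ) hcard.le, hcard]
  refine Finset.sum_congr rfl fun i _ => ?_
  rw [evalMono_insert hlγ, evalMono_insert hlν, Nat.sub_self]
  ring

theorem IsGenerating.solvesG (h1 : p + 1 ≤ m) (c : Fin r → ℂ) {u : Fin r → Vec n}
    (hu : ∀ i, u i 0 = 1) {G : Matrix ↥(B0 n k p r) ↥(B1 n k p) ℂ} (hG : IsGenerating u G) :
    SolvesG k p r (∑ i, c i • tensorPower m (u i)) G := by
  intro α
  ext γ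
  rw [vecB_apply h1 c u α.2 γ]
  refine (matA_mulVec_eq_sum h1 c u α.1 γ fun β => G β α).trans ?_
  simp only [hG α, hu, mul_one]

/-- If `A[α, F]` is injective for a sum `F` of `r` powers, then the leading entries of the points
are nonzero, and their monomial vectors are independent. -/
theorem nondegenerate_of_injective (h1 : p + 1 ≤ m)
    (hcard : Fintype.card ↥(B0 n k p r) = r) (q : Fin r → Vec n) (α : Finset (Fin (n + 1)))
    (hinj : ∀ y : ↥(B0 n k p r) → ℂ,
      (∀ γ, ∑ β, matA k p r (∑ i, tensorPower m (q i)) α γ β * y β = 0) → y = 0) :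
    (∀ i, q i 0 ≠ 0) ∧ LinearIndependent ℂ fun i => monoB0 k p r (q i) := by
  have hsum : ∑ i, tensorPower m (q i) = ∑ i, (1 : ℂ) • tensorPower m (q i) := by simp
  rw [hsum] at hinj
  simp only [matA_mulVec_eq_sum h1, one_mul] at hinj
  -- By the factorisation, a vector killed by evaluation on `𝓑₀` is killed by `A`; the square
  -- evaluation matrix is therefore injective, hence onto.
  have hs := (surjective_iff_injective_square hcard fun i => monoB0 k p r (q i)).mpr
    fun g hg => hinj g fun γ => by
      simp only [hg, mul_zero, zero_mul, Finset.sum_const_zero]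
  refine ⟨fun i h0 => ?_, linearIndependent_of_surjective hs⟩
  -- The polynomial dual to the `i`-th point is sent by `A` to a multiple of `q i 0`, so it would
  -- lie in the kernel if `q i 0 = 0`.
  obtain ⟨g, hg⟩ := hs (Pi.single i 1)
  have hg0 : g = 0 := by
    refine hinj g fun γ => Finset.sum_eq_zero fun j _ => ?_
    rw [hg j]
    by_cases hj : j = i
    · subst hj; simp [h0]
    · simp [hj]
  have := hg i
  simp [hg0] at this

end GeneratingMatrix

/-! ### Generic decompositions and their independence properties -/

/-- A decomposition `∑ lamᵢ uᵢ^{⊗ m}`, normalised by `(uᵢ)₀ = 1`, that satisfies the genericity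
conditions under which the algorithm recovers it. -/
structure GenericDecomposition {n r : ℕ} (m k p : ℕ) (ξ : ↥(high n k) → ℂ) (lam : Fin r → ℂ)
    (u : Fin r → Vec n) : Prop where
  p_pos : 1 ≤ p
  p_le : p + 2 ≤ m
  high_nonempty : 0 < r → (high n k).Nonempty
  lam_ne : ∀ i, lam i ≠ 0
  u_zero : ∀ i, u i 0 = 1
  indep_B0 : LinearIndependent ℂ fun i => monoB0 k p r (u i)
  indep_O : ∀ α ∈ B1 n k p, LinearIndependent ℂ
    fun (i : Fin r) (γ : ↥(O n m k p α)) => evalMono (u i).ofLp γ.1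
  simple : Function.Injective fun i => ∑ l, ξ l * u i l.1

namespace GenericDecomposition

variable {m n k p r : ℕ} {ξ : ↥(high n k) → ℂ} {lam : Fin r → ℂ} {u : Fin r → Vec n}

theorem exists_monomial_ne (h : GenericDecomposition m k p ξ lam u) (i : Fin r) :
    ∃ β ∈ J1 n k p, evalMono (u i).ofLp β ≠ 0 := by
  by_contra! hcon
  exact h.indep_B0.ne_zero i (funext fun β => hcon β.1 (mem_J1_of_mem_B0 β.2))

theorem exists_mem_B1 (h : GenericDecomposition m k p ξ lam u) (i : Fin r)
    {l : Fin (n + 1)} (hl : l ∈ high n k) : ∃ ν ∈ J1 n k p, insert l ν ∈ B1 n k p := by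
  obtain ⟨ν, hν, -⟩ := h.exists_monomial_ne i
  exact ⟨ν, hν, Finset.mem_image₂_of_mem hl hν⟩

theorem exists_B1 (h : GenericDecomposition m k p ξ lam u) (i : Fin r) :
    ∃ α, α ∈ B1 n k p := by
  obtain ⟨l, hl⟩ := h.high_nonempty (Fin.pos i)
  obtain ⟨ν, -, hν⟩ := h.exists_mem_B1 i hl
  exact ⟨_, hν⟩

/-- A single `𝓞_α ⊆ J₂` suffices. The index `i` is fixed first because it guarantees `r > 0`, hence
that `𝓑₁` is nonempty. -/
theorem indep_J2 (h : GenericDecomposition m k p ξ lam u) {y : Fin r → ℂ}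
    (hy : ∀ S ∈ J2 n m k p, ∑ i, y i * evalMono (u i).ofLp S = 0) : y = 0 := by
  ext i
  obtain ⟨α, hα⟩ := h.exists_B1 i
  rw [eq_zero_of_linearIndependent (h.indep_O α hα) fun γ => hy γ.1 (mem_O.mp γ.2).1]

/-- Multiplying the monomials of `𝓞_α` by the variable `x_l` of `α` gives squarefree monomials of
degree `m - p`, so (iii) kills each `y i * u i l`; then `l` is chosen with `u i l ≠ 0`. This degree
is needed to recover coefficients of degree `p - 1` in the low variables. -/
theorem indep_high (h : GenericDecomposition m k p ξ lam u) {y : Fin r → ℂ}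
    (hy : ∀ S ∈ (high n k).powersetCard (m - p), ∑ i, y i * evalMono (u i).ofLp S = 0) :
    y = 0 := by
  ext i
  -- If all high coordinates of `u i` vanished, so would all its values on `𝓞_α`, whose monomials
  -- have degree `m - p - 1 ≥ 1`.
  obtain ⟨l, hl, hul⟩ : ∃ l ∈ high n k, u i l ≠ 0 := by
    obtain ⟨α, hα⟩ := h.exists_B1 i
    by_contra! hcon
    refine (h.indep_O α hα).ne_zero i (funext fun γ => ?_)
    obtain ⟨hγ, hγc⟩ := mem_J2.mp (mem_O.mp γ.2).1
    have hne : γ.1.Nonempty := by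
      rw [← Finset.card_pos, hγc]
      have := h.p_le
      omega
    obtain ⟨j, hj⟩ := hne
    exact Finset.prod_eq_zero hj (hcon j (hγ hj))
  obtain ⟨ν, hν, hα⟩ := h.exists_mem_B1 i hl
  have h0 : (fun i => y i * u i l) = 0 := by
    refine eq_zero_of_linearIndependent (h.indep_O _ hα) fun γ => ?_
    obtain ⟨hγJ, hγd⟩ := mem_O.mp γ.2
    obtain ⟨hγ, hγc⟩ := mem_J2.mp hγJ
    have hlγ : l ∉ γ.1 := fun h => Finset.disjoint_left.mp hγd h (Finset.mem_insert_self _ _)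
    have := hy (insert l γ.1) (Finset.mem_powersetCard.mpr ⟨Finset.insert_subset hl hγ, by
      rw [Finset.card_insert_of_notMem hlγ, hγc]
      have := h.p_le
      omega⟩)
    simpa only [evalMono_insert hlγ, mul_assoc] using this
  simpa [hul] using congrFun h0 i

/-- All three factors are injective: the outer one by independence on `𝓞_α`, the diagonal by `lam i
≠ 0`, and the evaluation on `𝓑₀` because it is square and onto. -/
theorem matA_injective (h : GenericDecomposition m k p ξ lam u) {α : Finset (Fin (n + 1))}
    (hα : α ∈ B1 n k p) {y : ↥(B0 n k p r) → ℂ}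
    (hy : ∀ γ, ∑ β, matA k p r (∑ i, lam i • tensorPower m (u i)) α γ β * y β = 0) : y = 0 := by
  have hp := h.p_le
  simp only [matA_mulVec_eq_sum (show p + 1 ≤ m by omega)] at hy
  have h0 := eq_zero_of_linearIndependent (h.indep_O α hα) hy
  refine (surjective_iff_injective_square (card_B0_eq h.indep_B0) _).mp
    (exists_solution_of_linearIndependent h.indep_B0) y fun i => ?_
  simpa [h.lam_ne i, h.u_zero i] using congrFun h0 i

/-- The points of a generic decomposition have independent tensor powers on `Ω_m`. -/
theorem indep_Omega (h : GenericDecomposition m k p ξ lam u) {y : Fin r → ℂ}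
    (hy : ∀ t ∈ Omega m n, ∑ i, y i * tensorPower m (u i) t = 0) : y = 0 := by
  have hp := h.p_le
  ext i
  obtain ⟨β, hβ, hne⟩ := h.exists_monomial_ne i
  obtain ⟨hβs, hβc⟩ := mem_J1.mp hβ
  have h0 : (fun i => y i * evalMono (u i).ofLp β) = 0 := by
    refine h.indep_J2 fun S hS => ?_
    obtain ⟨hSs, hSc⟩ := mem_J2.mp hS
    have h1 := hy _ (label_union_mem_Omega (m := m) hβs hSs (by omega))
    have h2 := entry_sum_union_one (m := m) y h.u_zero hβs hSs (by omega)
    rw [← h2, entry]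
    simpa [Finset.sum_apply] using h1
  simpa [hne] using congrFun h0 i

end GenericDecomposition

/-! ### From asymptotic estimates to uniform constants -/

section Conversion

variable {m n r : ℕ} {T : Type*} {l : Filter T} {d : T → ℝ}

theorem norm_le_sum_norm {ι : Type*} [Fintype ι] (x : EuclideanSpace ℂ ι) :
    ‖x‖ ≤ ∑ j, ‖x j‖ := by
  rw [EuclideanSpace.norm_eq]
  exact Real.sqrt_le_iff.mpr ⟨Finset.sum_nonneg fun _ _ => norm_nonneg _,
    Finset.sum_sq_le_sq_sum_of_nonneg fun _ _ => norm_nonneg _⟩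

theorem CloseUpToRoots.mono {a q : Fin r → Vec n} {δ δ' : ℝ} (h : CloseUpToRoots m a q δ)
    (hδ : δ ≤ δ') : CloseUpToRoots m a q δ' := by
  obtain ⟨σ, η, hη, hc⟩ := h
  exact ⟨σ, η, hη, fun i => (hc i).trans hδ⟩

theorem exists_closeUpToRoots_of_near (hd0 : ∀ t, 0 ≤ d t) {a : T → Fin r → Vec n}
    {q : Fin r → Vec n} {σ : T → Equiv.Perm (Fin r)} {η : T → Fin r → ℂ}
    (hη : ∀ t i, η t i ^ m = 1)
    (h : ∀ i j, Near l d (fun t => η t i * a t (σ t i) j) (q i j)) :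
    ∃ C > 0, ∀ᶠ t in l, CloseUpToRoots m (a t) q (C * d t) := by
  have h1 : (fun t => ∑ i, ∑ j, ‖η t i * a t (σ t i) j - q i j‖) =O[l] d :=
    IsBigO.fun_sum fun i _ => IsBigO.fun_sum fun j _ => (h i j).norm_left
  obtain ⟨C, hC, hbound⟩ := h1.exists_pos
  refine ⟨C, hC, ?_⟩
  filter_upwards [hbound.bound] with t ht
  rw [Real.norm_of_nonneg (hd0 t)] at ht
  -- The estimates match `q i` with `a (σ i)`, whereas `CloseUpToRoots` indexes by the members of
  -- `a`; hence the inverse permutation.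
  refine ⟨(σ t).symm, fun i => η t ((σ t).symm i), fun i => hη t _, fun i => ?_⟩
  refine le_trans ?_ ((le_abs_self _).trans ht)
  obtain ⟨i', rfl⟩ := (σ t).surjective i
  simp only [Equiv.symm_apply_apply]
  have hsingle := Finset.single_le_sum (s := Finset.univ)
    (f := fun i' => ∑ j, ‖η t i' * a t (σ t i') j - q i' j‖)
    (fun _ _ => Finset.sum_nonneg fun _ _ => norm_nonneg _) (Finset.mem_univ i')
  exact (norm_le_sum_norm _).trans hsingle

theorem tendsto_comap_zero (d : T → ℝ) : Tendsto d (comap d (𝓝 0)) (𝓝 0) := tendsto_comap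

/-- Neighbourhoods in `comap d (𝓝 0)` contain a full set `d < ε`, so whatever data the index type
records is covered by one `ε`. -/
theorem exists_of_eventually_comap {P : T → Prop} (hd0 : ∀ t, 0 ≤ d t)
    (h : ∀ᶠ t in comap d (𝓝 0), P t) : ∃ ε > 0, ∀ t, d t < ε → P t := by
  rw [eventually_comap] at h
  obtain ⟨ε, hε, hP⟩ := Metric.eventually_nhds_iff.mp h
  refine ⟨ε, hε, fun t ht => hP ?_ t rfl⟩
  rwa [Real.dist_eq, sub_zero, abs_of_nonneg (hd0 t)]

theorem Near.evalMono (hd : Tendsto d l (𝓝 0)) {x : T → Fin (n + 1) → ℂ} {y : Fin (n + 1) → ℂ}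
    {S : Finset (Fin (n + 1))} (h : ∀ j ∈ S, Near l d (fun t => x t j) (y j)) :
    Near l d (fun t => evalMono (x t) S) (evalMono y S) :=
  Near.prod hd S h

theorem near_of_distOmega_le {F : Tensor m n} {Fh : T → Tensor m n}
    (h : ∀ t, distOmega (Fh t) F ≤ d t) {τ : Fin m → Fin (n + 1)} (hτ : τ ∈ Omega m n) :
    Near l d (fun t => Fh t τ) (F τ) :=
  IsBigO.of_bound 1 (Eventually.of_forall fun t => by
    rw [one_mul]
    exact ((norm_sub_le_distOmega _ _ hτ).trans (h t)).trans (le_abs_self _))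

theorem tensorPower_smul (c : ℂ) (x : Vec n) :
    tensorPower m (c • x) = c ^ m • tensorPower m x := by
  ext t
  simp [tensorPower, Finset.prod_mul_distrib]

theorem wVec_of_eigenvector {k p : ℕ} {G : Matrix ↥(B0 n k p r) ↥(B1 n k p) ℂ}
    {z : EuclideanSpace ℂ ↥(B0 n k p r)} (hz : ‖z‖ = 1) {l : Fin (n + 1)} (hl : l ∈ high n k)
    {w : ℂ} (hw : (matN G ⟨l, hl⟩).mulVec z.ofLp = w • z.ofLp) : wVec G z l = w := by
  rw [wVec, dif_pos hl, hw, dotProduct_smul]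
  have h : inner ℂ z z = dotProduct (star z.ofLp) z.ofLp := by
    rw [dotProduct_comm]
    rfl
  rw [← h, inner_self_eq_norm_sq_to_K, hz]
  simp

theorem smul_monoB0 {k p : ℕ} (c : ℂ) (x : Vec n) :
    monoB0 k p r (c • x) = c ^ p • monoB0 k p r x := by
  ext β
  have := evalMono_smul c x β.1
  rw [(mem_J1.mp (mem_J1_of_mem_B0 β.2)).2] at this
  exact this

end Conversion

/-! ### Perturbation of the generating matrix and of the recovered coordinates -/

namespace GenericDecomposition

variable {m n k p r : ℕ} {ξ : ↥(high n k) → ℂ} {lam : Fin r → ℂ} {u : Fin r → Vec n}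
  {T : Type*} {l : Filter T} {d : T → ℝ} {Fh : T → Tensor m n}

theorem near_matA (h : GenericDecomposition m k p ξ lam u) {F : Tensor m n}
    (hF : ∀ τ ∈ Omega m n, Near l d (fun t => Fh t τ) (F τ))
    (α : Finset (Fin (n + 1))) (γ : ↥(O n m k p α)) (β : ↥(B0 n k p r)) :
    Near l d (fun t => matA k p r (Fh t) α γ β) (matA k p r F α γ β) := by
  have hp := h.p_le
  obtain ⟨hβ, hβc⟩ := mem_J1.mp (mem_J1_of_mem_B0 β.2)
  obtain ⟨hγ, hγc⟩ := mem_J2.mp (mem_O.mp γ.2).1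
  exact hF _ (label_union_mem_Omega hβ hγ (by omega))

theorem near_vecB (h : GenericDecomposition m k p ξ lam u) {F : Tensor m n}
    (hF : ∀ τ ∈ Omega m n, Near l d (fun t => Fh t τ) (F τ))
    {α : Finset (Fin (n + 1))} (hα : α ∈ B1 n k p) (γ : ↥(O n m k p α)) :
    Near l d (fun t => vecB k p (Fh t) α γ) (vecB k p F α γ) := by
  have hp := h.p_le
  obtain ⟨i, hi, ν, hν, rfl⟩ := exists_eq_insert_of_mem_B1 hα
  obtain ⟨hνs, hνc⟩ := mem_J1.mp hν
  obtain ⟨hγJ, hγd⟩ := mem_O.mp γ.2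
  obtain ⟨hγ, hγc⟩ := mem_J2.mp hγJ
  have hiγ : i ∉ γ.1 := fun h => Finset.disjoint_left.mp hγd h (Finset.mem_insert_self _ _)
  simp only [vecB, union_eq_insert_union]
  refine hF _ (label_union_mem_Omega hνs (Finset.insert_subset hi hγ) ?_)
  rw [Finset.card_insert_of_notMem hiγ]
  omega

/-- Comparison with `G₀` alone is assumed, so that this covers both the least squares solutions of
the algorithm and the exact generating matrices of nearby decompositions. -/
theorem near_generating (h : GenericDecomposition m k p ξ lam u) (hd : Tendsto d l (𝓝 0))
    (hF : ∀ τ ∈ Omega m n,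
      Near l d (fun t => Fh t τ) ((∑ i, lam i • tensorPower m (u i)) τ))
    {G₀ : Matrix ↥(B0 n k p r) ↥(B1 n k p) ℂ} (hG₀ : IsGenerating u G₀)
    {G : T → Matrix ↥(B0 n k p r) ↥(B1 n k p) ℂ}
    (hG : ∀ᶠ t in l, ∀ α : ↥(B1 n k p), objG k p r (Fh t) α.1 (fun β => G t β α) ≤
      objG k p r (Fh t) α.1 (fun β => G₀ β α)) (β : ↥(B0 n k p r)) (α : ↥(B1 n k p)) :
    Near l d (fun t => G t β α) (G₀ β α) := by
  have hp := h.p_le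
  have hsolve := hG₀.solvesG (show p + 1 ≤ m by omega) lam h.u_zero α
  refine near_of_leastSquares (x := fun t β => G t β α) (x₀ := fun β => G₀ β α) hd Finset.univ
    (fun γ _ β => h.near_matA hF α.1 γ β) (fun γ _ => h.near_vecB hF α.2 γ)
    (fun y hy => h.matA_injective α.2 fun γ => hy γ (Finset.mem_univ _))
    (fun γ _ => congrFun hsolve γ) ?_ β
  filter_upwards [hG] with t ht
  simpa only [objG, norm_sub_rev, Matrix.mulVec, dotProduct] using ht α

theorem near_matNxi {G₀ : Matrix ↥(B0 n k p r) ↥(B1 n k p) ℂ}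
    {G : T → Matrix ↥(B0 n k p r) ↥(B1 n k p) ℂ} (hd : Tendsto d l (𝓝 0))
    (hG : ∀ β α, Near l d (fun t => G t β α) (G₀ β α)) (ξ : ↥(high n k) → ℂ)
    (ν β : ↥(B0 n k p r)) : Near l d (fun t => matNxi ξ (G t) ν β) (matNxi ξ G₀ ν β) := by
  simp only [matNxi, Matrix.sum_apply, Matrix.smul_apply, smul_eq_mul]
  exact Near.sum _ fun l _ => (Near.const (ξ l)).mul hd (hG _ _)

/-- The eigenlines of `N(ξ)` are stable, and in the limit they are eigenlines of every `N_j(G₀)`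
with eigenvalue `u i j`, which the Rayleigh quotients approximate. -/
theorem exists_perm_near_wVec (h : GenericDecomposition m k p ξ lam u) (hd : Tendsto d l (𝓝 0))
    {G₀ : Matrix ↥(B0 n k p r) ↥(B1 n k p) ℂ} (hG₀ : IsGenerating u G₀)
    {G : T → Matrix ↥(B0 n k p r) ↥(B1 n k p) ℂ}
    (hG : ∀ β α, Near l d (fun t => G t β α) (G₀ β α))
    {z : T → Fin r → EuclideanSpace ℂ ↥(B0 n k p r)} {e : T → Fin r → ℂ}
    (hz1 : ∀ᶠ t in l, ∀ i, ‖z t i‖ = 1)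
    (hze : ∀ᶠ t in l, ∀ i, (matNxi ξ (G t)).mulVec (z t i).ofLp = e t i • (z t i).ofLp)
    (hzl : ∀ᶠ t in l, LinearIndependent ℂ (z t)) :
    ∃ σ : T → Equiv.Perm (Fin r), ∀ i, ∀ j ∈ high n k,
      Near l d (fun t => wVec (G t) (z t (σ t i)) j) (u i j) := by
  obtain ⟨σ, hσ⟩ := exists_perm_eigenvectors_near (card_B0_eq h.indep_B0) hd
    (near_matNxi hd hG ξ) h.indep_B0 (hG₀.matNxi_mulVec ξ) h.simple hz1 hze hzl
  refine ⟨σ, fun i j hj => ?_⟩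
  obtain ⟨c, hc⟩ := hσ i
  simp only [wVec, dif_pos hj]
  exact near_rayleigh (fun ν β => hG _ _) (hG₀.matN_mulVec i ⟨j, hj⟩)
    (hz1.mono fun t ht => ht _) hc

/-- Recovery of the coefficients `lamᵢ uᵢ^β` from the last coordinates of the points. -/
theorem near_coefficient (h : GenericDecomposition m k p ξ lam u) (hd : Tendsto d l (𝓝 0))
    (hF : ∀ τ ∈ Omega m n,
      Near l d (fun t => Fh t τ) ((∑ i, lam i • tensorPower m (u i)) τ))
    {w : T → Fin r → Fin (n + 1) → ℂ}
    (hw : ∀ i, ∀ j ∈ high n k, Near l d (fun t => w t i j) (u i j))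
    {β : Finset (Fin (n + 1))} (hβ : β ⊆ low n k) {b : ℕ} (hb : β.card + b ≤ m)
    (hb' : m ≤ β.card + b + 1)
    (hinj : ∀ y : Fin r → ℂ,
      (∀ S ∈ (high n k).powersetCard b, ∑ i, y i * evalMono (u i).ofLp S = 0) → y = 0)
    {x : T → Fin r → ℂ}
    (hx : ∀ᶠ t in l, ∀ S ∈ (high n k).powersetCard b,
      ∑ i, x t i * evalMono (w t i) S = entry (Fh t) (β ∪ S)) (i : Fin r) :
    Near l d (fun t => x t i) (lam i * evalMono (u i).ofLp β) := by
  refine near_of_solves (ι := Finset (Fin (n + 1))) hd ((high n k).powersetCard b)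
    (A := fun t S i => evalMono (w t i) S) (A₀ := fun S i => evalMono (u i).ofLp S)
    (b := fun t S => entry (Fh t) (β ∪ S))
    (b₀ := fun S => entry (∑ i, lam i • tensorPower m (u i)) (β ∪ S))
    (x₀ := fun i => lam i * evalMono (u i).ofLp β) ?_ ?_ ?_ ?_ ?_ i
  · intro S hS i
    exact Near.evalMono hd fun j hj => hw i j ((Finset.mem_powersetCard.mp hS).1 hj)
  · intro S hS
    obtain ⟨hSs, hSc⟩ := Finset.mem_powersetCard.mp hS
    exact hF _ (label_union_mem_Omega hβ hSs (by omega))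
  · intro y hy
    exact hinj y fun S hS => by simpa only [mul_comm] using hy S hS
  · intro S hS
    obtain ⟨hSs, hSc⟩ := Finset.mem_powersetCard.mp hS
    rw [entry_sum_union_one lam h.u_zero hβ hSs (by omega)]
    exact Finset.sum_congr rfl fun i _ => by ring
  · filter_upwards [hx] with t ht S hS
    rw [← ht S hS]
    exact Finset.sum_congr rfl fun i _ => by ring

end GenericDecomposition

/-! ### Stability of the decomposition itself -/

namespace GenericDecomposition

variable {m n k p r : ℕ} {ξ : ↥(high n k) → ℂ} {lam : Fin r → ℂ} {u : Fin r → Vec n}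
  {T : Type*} {l : Filter T} {d : T → ℝ}

/-- A sum of `r` powers near a generic tensor has a nondegenerate decomposition. -/
theorem eventually_nondegenerate (h : GenericDecomposition m k p ξ lam u)
    (hd : Tendsto d l (𝓝 0)) {q : T → Fin r → Vec n}
    (hF : ∀ τ ∈ Omega m n, Near l d (fun t => (∑ i, tensorPower m (q t i)) τ)
      ((∑ i, lam i • tensorPower m (u i)) τ)) :
    ∀ᶠ t in l, (∀ i, q t i 0 ≠ 0) ∧ LinearIndependent ℂ fun i => monoB0 k p r (q t i) := by
  rcases Nat.eq_zero_or_pos r with rfl | hr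
  · exact Eventually.of_forall fun t => ⟨fun i => i.elim0, linearIndependent_empty_type⟩
  have hp := h.p_le
  obtain ⟨α, hα⟩ := h.exists_B1 ⟨0, hr⟩
  obtain ⟨K, -, hK⟩ := exists_lower_bound hd Finset.univ
    (A := fun t γ β => matA k p r (∑ i, tensorPower m (q t i)) α γ β)
    (fun γ _ β => h.near_matA hF α γ β)
    (fun y hy => h.matA_injective hα fun γ => hy γ (Finset.mem_univ _))
  filter_upwards [hK] with t ht
  refine nondegenerate_of_injective (m := m) (by omega) (card_B0_eq h.indep_B0) (q t) α fun y hy => ?_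
  have h1 := ht y
  rw [Finset.sum_eq_zero fun γ _ => by rw [hy γ, norm_zero], mul_zero] at h1
  exact norm_le_zero_iff.mp h1

/-- The last coordinates of the points of normalised decompositions of tensors near a generic
one. -/
theorem exists_perm_near_high (h : GenericDecomposition m k p ξ lam u)
    (hd : Tendsto d l (𝓝 0)) {c : T → Fin r → ℂ} {x : T → Fin r → Vec n}
    (hF : ∀ τ ∈ Omega m n, Near l d (fun t => (∑ i, c t i • tensorPower m (x t i)) τ)
      ((∑ i, lam i • tensorPower m (u i)) τ))
    (hx0 : ∀ᶠ t in l, ∀ i, x t i 0 = 1)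
    (hxl : ∀ᶠ t in l, LinearIndependent ℂ fun i => monoB0 k p r (x t i)) :
    ∃ σ : T → Equiv.Perm (Fin r), ∀ i, ∀ j ∈ high n k,
      Near l d (fun t => x t (σ t i) j) (u i j) := by
  classical
  have hp := h.p_le
  obtain ⟨G₀, hG₀⟩ := exists_isGenerating h.indep_B0
  -- The generating matrix of the nearby points solves the nearby systems with residual zero. The
  -- zero matrix is a default where independence fails.
  let G : T → Matrix ↥(B0 n k p r) ↥(B1 n k p) ℂ := fun t =>
    if ht : LinearIndependent ℂ fun i => monoB0 k p r (x t i) then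
      (exists_isGenerating ht).choose else 0
  have hG : ∀ᶠ t in l, IsGenerating (x t) (G t) := by
    filter_upwards [hxl] with t ht
    simp only [G, dif_pos ht]
    exact (exists_isGenerating ht).choose_spec
  have hnear := h.near_generating hd hF hG₀ (G := G) (by
    filter_upwards [hG, hx0] with t h1 h2 α
    have h3 := h1.solvesG (show p + 1 ≤ m by omega) (c t) h2 α
    rw [objG, Finset.sum_eq_zero fun γ _ => by rw [congrFun h3 γ]; simp]
    exact Finset.sum_nonneg fun _ _ => sq_nonneg _)
  let y : T → Fin r → EuclideanSpace ℂ ↥(B0 n k p r) := fun t i =>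
    WithLp.toLp 2 (monoB0 k p r (x t i))
  let z : T → Fin r → EuclideanSpace ℂ ↥(B0 n k p r) := fun t i =>
    ((‖y t i‖⁻¹ : ℝ) : ℂ) • y t i
  have hy0 : ∀ᶠ t in l, ∀ i, ‖y t i‖ ≠ 0 := by
    filter_upwards [hxl] with t ht i h0
    refine ht.ne_zero i ?_
    rw [norm_eq_zero] at h0
    exact congrArg WithLp.ofLp h0
  have hz1 : ∀ᶠ t in l, ∀ i, ‖z t i‖ = 1 := by
    filter_upwards [hy0] with t ht i
    simp only [z]
    rw [norm_smul, Complex.norm_real, norm_inv, norm_norm]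
    exact inv_mul_cancel₀ (ht i)
  have hzN : ∀ᶠ t in l, ∀ i j, (matN (G t) j).mulVec (z t i).ofLp =
      x t i j.1 • (z t i).ofLp := by
    filter_upwards [hG] with t ht i j
    simp only [z, y, WithLp.ofLp_smul, Matrix.mulVec_smul, ht.matN_mulVec]
    rw [smul_comm]
  have hzl : ∀ᶠ t in l, LinearIndependent ℂ (z t) := by
    filter_upwards [hxl, hy0] with t h1 h2
    have h3 : LinearIndependent ℂ (y t) :=
      h1.map' (WithLp.linearEquiv 2 ℂ _).symm.toLinearMap
        (LinearMap.ker_eq_bot.mpr (WithLp.linearEquiv 2 ℂ _).symm.injective)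
    exact h3.units_smul fun i => Units.mk0 ((‖y t i‖⁻¹ : ℝ) : ℂ) (by
      exact_mod_cast inv_ne_zero (h2 i))
  obtain ⟨σ, hσ⟩ := h.exists_perm_near_wVec hd hG₀ hnear (z := z)
    (e := fun t i => ∑ j, ξ j * x t i j.1) hz1 (by
      filter_upwards [hzN] with t ht i
      simp only [matNxi, Matrix.sum_mulVec, Matrix.smul_mulVec, ht, smul_smul,
        Finset.sum_smul]) hzl
  refine ⟨σ, fun i j hj => (hσ i j hj).congr' ?_⟩
  filter_upwards [hz1, hzN] with t h1 h2
  exact wVec_of_eigenvector (h1 _) hj (h2 _ ⟨j, hj⟩)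

/-- Normalised decompositions of tensors near a generic one. -/
theorem exists_perm_near (h : GenericDecomposition m k p ξ lam u)
    (hd : Tendsto d l (𝓝 0)) {c : T → Fin r → ℂ} {x : T → Fin r → Vec n}
    (hF : ∀ τ ∈ Omega m n, Near l d (fun t => (∑ i, c t i • tensorPower m (x t i)) τ)
      ((∑ i, lam i • tensorPower m (u i)) τ))
    (hx0 : ∀ᶠ t in l, ∀ i, x t i 0 = 1)
    (hxl : ∀ᶠ t in l, LinearIndependent ℂ fun i => monoB0 k p r (x t i)) :
    ∃ σ : T → Equiv.Perm (Fin r), ∀ i, Near l d (fun t => c t (σ t i)) (lam i) ∧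
      ∀ j, Near l d (fun t => x t (σ t i) j) (u i j) := by
  have hp := h.p_le
  have hp' := h.p_pos
  obtain ⟨σ, hσ⟩ := h.exists_perm_near_high hd hF hx0 hxl
  -- The degrees `p - 1`, `p`, `p + 1` of `β` are completed by high monomials of degree `m - p`, `m
  -- - p - 1`, `m - p - 1`; the total is `m - 1` or `m`, as `Ω_m` requires.
  have hcoef : ∀ β ⊆ low n k, p ≤ β.card + 1 → β.card ≤ p + 1 → ∀ i,
      Near l d (fun t => c t (σ t i) * evalMono (x t (σ t i)).ofLp β)
        (lam i * evalMono (u i).ofLp β) := by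
    intro β hβ h1 h2 i
    have hsolve : ∀ b, β.card + b ≤ m → ∀ᶠ t in l, ∀ S ∈ (high n k).powersetCard b,
        ∑ i, c t (σ t i) * evalMono (x t (σ t i)).ofLp β * evalMono (x t (σ t i)).ofLp S =
          entry (∑ i, c t i • tensorPower m (x t i)) (β ∪ S) := by
      intro b hb
      filter_upwards [hx0] with t ht S hS
      obtain ⟨hSs, hSc⟩ := Finset.mem_powersetCard.mp hS
      rw [entry_sum_union_one (c t) ht hβ hSs (by omega)]
      exact Equiv.sum_comp (σ t)
        fun i => c t i * evalMono (x t i).ofLp β * evalMono (x t i).ofLp S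
    by_cases hlt : β.card < p
    · exact h.near_coefficient hd hF (w := fun t i => (x t (σ t i)).ofLp) hσ hβ
        (b := m - p) (by omega) (by omega) (fun y => h.indep_high) (hsolve _ (by omega)) i
    · exact h.near_coefficient hd hF (w := fun t i => (x t (σ t i)).ofLp) hσ hβ
        (b := m - p - 1) (by omega) (by omega) (fun y => h.indep_J2) (hsolve _ (by omega)) i
  -- A low coordinate is the quotient of the coefficients at `x_j x^β` and at `x^β`.
  have hratio : ∀ i, ∀ j ∈ low n k, ∀ β ⊆ low n k, j ∉ β → p ≤ β.card + 1 → β.card ≤ p →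
      evalMono (u i).ofLp β ≠ 0 → Near l d (fun t => x t (σ t i) j) (u i j) := by
    intro i j hj β hβ hjβ h1 h2 hne
    have hne' : lam i * evalMono (u i).ofLp β ≠ 0 := mul_ne_zero (h.lam_ne i) hne
    have h3 := hcoef β hβ h1 (by omega) i
    have h4 := hcoef (insert j β) (Finset.insert_subset hj hβ)
      (by rw [Finset.card_insert_of_notMem hjβ]; omega)
      (by rw [Finset.card_insert_of_notMem hjβ]; omega) i
    have h5 := h4.div hd h3 hne'
    rw [evalMono_insert hjβ, mul_left_comm, mul_div_assoc, div_self hne', mul_one] at h5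
    refine h5.congr' ?_
    filter_upwards [h3.eventually_ne hd hne'] with t ht
    rw [evalMono_insert hjβ, mul_left_comm, mul_div_assoc, div_self ht, mul_one]
  have hx : ∀ i j, Near l d (fun t => x t (σ t i) j) (u i j) := by
    intro i j
    by_cases hj0 : j = 0
    · subst hj0
      rw [h.u_zero]
      refine (Near.const 1).congr' ?_
      filter_upwards [hx0] with t ht
      rw [ht]
    rcases mem_low_or_high (k := k) hj0 with hj | hj
    · obtain ⟨β, hβ, hne⟩ := h.exists_monomial_ne i
      obtain ⟨hβs, hβc⟩ := mem_J1.mp hβ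
      -- If `x_j` divides `β`, the quotient is taken from `β` without `x_j`, of degree `p - 1`. This
      -- alternative makes the condition on `J₁^{-j}` unnecessary here.
      by_cases hjβ : j ∈ β
      · refine hratio i j hj (β.erase j) ((Finset.erase_subset _ _).trans hβs)
          (Finset.notMem_erase j β) (by rw [Finset.card_erase_of_mem hjβ]; omega)
          (by rw [Finset.card_erase_of_mem hjβ]; omega) fun h0 => hne ?_
        rw [← Finset.insert_erase hjβ, evalMono_insert (Finset.notMem_erase j β), h0, mul_zero]
      · exact hratio i j hj β hβs hjβ (by omega) (by omega) hne
    · exact hσ i j hj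
  refine ⟨σ, fun i => ⟨?_, hx i⟩⟩
  obtain ⟨β, hβ, hne⟩ := h.exists_monomial_ne i
  obtain ⟨hβs, hβc⟩ := mem_J1.mp hβ
  have h1 := hcoef β hβs (by omega) (by omega) i
  have h2 : Near l d (fun t => evalMono (x t (σ t i)).ofLp β) (evalMono (u i).ofLp β) :=
    Near.evalMono hd fun j _ => hx i j
  have h3 := h1.div hd h2 hne
  rw [mul_div_cancel_right₀ _ hne] at h3
  refine h3.congr' ?_
  filter_upwards [h2.eventually_ne hd hne] with t ht
  rw [mul_div_cancel_right₀ _ ht]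

/-- Rescaled points, after the choice of a root of the coefficients. -/
theorem exists_root_near (h : GenericDecomposition m k p ξ lam u)
    (hd : Tendsto d l (𝓝 0)) {s : T → Fin r → ℂ} {x : T → Fin r → Vec n}
    {σ : T → Equiv.Perm (Fin r)}
    (hs : ∀ i, Near l d (fun t => s t (σ t i) ^ m) (lam i))
    (hx : ∀ i j, Near l d (fun t => x t (σ t i) j) (u i j))
    {s₀ : Fin r → ℂ} (hs₀ : ∀ i, s₀ i ^ m = lam i) :
    ∃ η : T → Fin r → ℂ, (∀ t i, η t i ^ m = 1) ∧
      ∀ i j, Near l d (fun t => η t i * (s t (σ t i) • x t (σ t i)) j) ((s₀ i • u i) j) := by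
  have hm : m ≠ 0 := by
    have := h.p_le
    omega
  have hs0 : ∀ i, s₀ i ≠ 0 := fun i h0 => h.lam_ne i (by rw [← hs₀, h0, zero_pow hm])
  choose η hη hηs using fun i =>
    Near.exists_root hm hd (s := fun t => s t (σ t i)) (s₀ := s₀ i) (by rw [hs₀]; exact hs i)
      (hs0 i)
  refine ⟨fun t i => η i t, fun t i => hη i t, fun i j => ?_⟩
  have := (hηs i).mul hd (hx i j)
  simpa only [PiLp.smul_apply, smul_eq_mul, mul_assoc] using this

/-- Stability of the decomposition. -/
theorem eventually_closeUpToRoots (h : GenericDecomposition m k p ξ lam u)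
    (hd : Tendsto d l (𝓝 0)) (hd0 : ∀ t, 0 ≤ d t) {q : T → Fin r → Vec n}
    (hF : ∀ t, distOmega (∑ i, tensorPower m (q t i))
      (∑ i, lam i • tensorPower m (u i)) ≤ d t)
    {s₀ : Fin r → ℂ} (hs₀ : ∀ i, s₀ i ^ m = lam i) :
    ∃ C > 0, ∀ᶠ t in l, CloseUpToRoots m (q t) (fun i => s₀ i • u i) (C * d t) := by
  have hF' : ∀ τ ∈ Omega m n, Near l d (fun t => (∑ i, tensorPower m (q t i)) τ)
      ((∑ i, lam i • tensorPower m (u i)) τ) := fun τ hτ =>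
    near_of_distOmega_le hF hτ
  have hnd := h.eventually_nondegenerate hd hF'
  -- Scaling by the leading entry turns `q i` into a normalised point with weight `(q i 0) ^ m`, of
  -- which `q i 0` is a root at hand.
  let c : T → Fin r → ℂ := fun t i => q t i 0 ^ m
  let x : T → Fin r → Vec n := fun t i => (q t i 0)⁻¹ • q t i
  have hsum : ∀ᶠ t in l, ∑ i, tensorPower m (q t i) = ∑ i, c t i • tensorPower m (x t i) := by
    filter_upwards [hnd] with t ht
    refine Finset.sum_congr rfl fun i _ => ?_
    rw [← tensorPower_smul, smul_inv_smul₀ (ht.1 i)]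
  obtain ⟨σ, hσ⟩ := h.exists_perm_near hd (c := c) (x := x)
    (fun τ hτ => (hF' τ hτ).congr' (hsum.mono fun t ht => by simp only [ht]))
    (by
      filter_upwards [hnd] with t ht i
      simp [x, ht.1 i])
    (by
      filter_upwards [hnd] with t ht
      have := ht.2.units_smul fun i =>
        Units.mk0 ((q t i 0)⁻¹ ^ p) (pow_ne_zero _ (inv_ne_zero (ht.1 i)))
      convert this using 1
      ext1 i
      simp only [x, smul_monoB0]
      rfl)
  obtain ⟨η, hη, hnear⟩ := h.exists_root_near hd (s := fun t i => q t i 0) (x := x) (σ := σ)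
    (fun i => (hσ i).1) (fun i => (hσ i).2) hs₀
  refine exists_closeUpToRoots_of_near (σ := σ) hd0 hη fun i j => (hnear i j).congr' ?_
  filter_upwards [hnd] with t ht
  simp only [x]
  rw [smul_inv_smul₀ (ht.1 _)]

end GenericDecomposition

/-! ### Existence of minimizers and their behaviour under permutations -/

section Minimizers

variable {m n k p r : ℕ}

theorem exists_isMinOn_objG (F : Tensor m n) (α : Finset (Fin (n + 1))) :
    ∃ g, IsMinOn (objG k p r F α) Set.univ g := by
  obtain ⟨g, hg⟩ := exists_leastSquares (matA k p r F α).mulVecLin Finset.univ (vecB k p F α)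
  refine ⟨g, ?_⟩
  convert hg using 1
  funext g
  simp [objG, norm_sub_rev]

theorem exists_isMinOn_objGamma (F : Tensor m n) (w : Fin r → Fin (n + 1) → ℂ) :
    ∃ γ, IsMinOn (objGamma k p F w) Set.univ γ := by
  let L : (Fin r → ↥(J1 n k p) → ℂ) →ₗ[ℂ] (↥(J1 n k p) × Finset (Fin (n + 1)) → ℂ) :=
    { toFun := fun γ a => ∑ i, γ i a.1 * evalMono (w i) a.2
      map_add' := fun _ _ => by ext; simp [add_mul, Finset.sum_add_distrib]
      map_smul' := fun _ _ => by ext; simp [Finset.mul_sum, mul_assoc] }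
  obtain ⟨γ, hγ⟩ := exists_leastSquares L (Finset.univ ×ˢ J2 n m k p)
    fun a => entry F (a.1.1 ∪ a.2)
  refine ⟨γ, ?_⟩
  convert hγ using 1
  funext γ
  rw [Finset.sum_product]
  rfl

theorem exists_isMinOn_objV (F : Tensor m n) (w : Fin r → Fin (n + 1) → ℂ)
    (γ : Fin r → ↥(J1 n k p) → ℂ) (j : Fin (n + 1)) :
    ∃ x, IsMinOn (objV k p F w γ j) Set.univ x := by
  let L : (Fin r → ℂ) →ₗ[ℂ] (↥(J1 n k p) × Finset (Fin (n + 1)) → ℂ) :=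
    { toFun := fun x a => ∑ i, x i * γ i a.1 * evalMono (w i) a.2
      map_add' := fun _ _ => by ext; simp [add_mul, Finset.sum_add_distrib]
      map_smul' := fun _ _ => by ext; simp [Finset.mul_sum, mul_assoc] }
  obtain ⟨x, hx⟩ := exists_leastSquares L
    ((Finset.univ.filter fun β : ↥(J1 n k p) => j ∉ β.1) ×ˢ J2 n m k p)
    fun a => entry F (insert j (a.1.1 ∪ a.2))
  refine ⟨x, ?_⟩
  convert hx using 1
  funext x
  rw [Finset.sum_product]
  rfl

theorem exists_isMinOn_objLambda (F : Tensor m n) (x : Fin r → Vec n) :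
    ∃ lam, IsMinOn (objLambda F x) Set.univ lam := by
  let L : (Fin r → ℂ) →ₗ[ℂ] Tensor m n :=
    { toFun := fun lam => ∑ i, lam i • tensorPower m (x i)
      map_add' := fun _ _ => by simp [add_smul, Finset.sum_add_distrib]
      map_smul' := fun _ _ => by simp [Finset.smul_sum, smul_smul] }
  exact exists_leastSquares L (Omega m n) F

theorem exists_algorithmRun {F : Tensor m n} {ξ : ↥(high n k) → ℂ}
    {G : Matrix ↥(B0 n k p r) ↥(B1 n k p) ℂ}
    (hG : ∀ α : ↥(B1 n k p), IsMinOn (objG k p r F α.1) Set.univ (fun β => G β α))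
    {z : Fin r → EuclideanSpace ℂ ↥(B0 n k p r)} {e : Fin r → ℂ} (hz1 : ∀ i, ‖z i‖ = 1)
    (hze : ∀ i, (matNxi ξ G).mulVec (z i).ofLp = e i • (z i).ofLp)
    (hzl : LinearIndependent ℂ z) {q : Fin r → Vec n} (hq : IsMinOn (objQ F) Set.univ q) :
    Nonempty (AlgorithmRun k p r F ξ) := by
  obtain ⟨γ, hγ⟩ := exists_isMinOn_objGamma (k := k) (p := p) F fun i => wVec G (z i)
  choose v hv using fun j : ↥(low n k) =>
    exists_isMinOn_objV F (fun i => wVec G (z i)) γ j.1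
  obtain ⟨lam, hlam⟩ := exists_isMinOn_objLambda F
    fun i => assemble (fun j => v j i) (wVec G (z i))
  exact ⟨⟨G, hG, z, e, hz1, hze, hzl, γ, hγ, fun i j => v j i, hv, lam, hlam, q, hq⟩⟩

theorem objGamma_comp_perm (F : Tensor m n) (w : Fin r → Fin (n + 1) → ℂ)
    (γ : Fin r → ↥(J1 n k p) → ℂ) (σ : Equiv.Perm (Fin r)) :
    objGamma k p F (fun i => w (σ i)) (fun i => γ (σ i)) = objGamma k p F w γ := by
  refine Finset.sum_congr rfl fun β _ => Finset.sum_congr rfl fun S _ => ?_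
  rw [Equiv.sum_comp σ fun i => γ i β * evalMono (w i) S]

theorem objV_comp_perm (F : Tensor m n) (w : Fin r → Fin (n + 1) → ℂ)
    (γ : Fin r → ↥(J1 n k p) → ℂ) (j : Fin (n + 1)) (x : Fin r → ℂ) (σ : Equiv.Perm (Fin r)) :
    objV k p F (fun i => w (σ i)) (fun i => γ (σ i)) j (fun i => x (σ i)) =
      objV k p F w γ j x := by
  refine Finset.sum_congr rfl fun β _ => Finset.sum_congr rfl fun S _ => ?_
  rw [Equiv.sum_comp σ fun i => x i * γ i β * evalMono (w i) S]

theorem objLambda_comp_perm (F : Tensor m n) (x : Fin r → Vec n) (c : Fin r → ℂ)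
    (σ : Equiv.Perm (Fin r)) :
    objLambda F (fun i => x (σ i)) (fun i => c (σ i)) = objLambda F x c := by
  rw [objLambda, objLambda, Equiv.sum_comp σ fun i => c i • tensorPower m (x i)]

/-- Minimality is preserved by a simultaneous permutation. -/
theorem le_of_isMinOn_comp_perm {κ : Type*} {f g : (Fin r → κ) → ℝ} {x : Fin r → κ}
    (hx : IsMinOn f Set.univ x) (σ : Equiv.Perm (Fin r)) (h : ∀ y, g (fun i => y (σ i)) = f y)
    (y : Fin r → κ) : g (fun i => x (σ i)) ≤ g y := by
  have h1 := h fun i => y (σ.symm i)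
  simp only [Equiv.symm_apply_apply] at h1
  rw [h, h1]
  exact hx (Set.mem_univ _)

end Minimizers

/-! ### Best approximations and the algebraic steps of the algorithm -/

namespace GenericDecomposition

variable {m n k p r : ℕ} {ξ : ↥(high n k) → ℂ} {lam : Fin r → ℂ} {u : Fin r → Vec n}

theorem sum_tensorPower_smul {s₀ : Fin r → ℂ} (hs₀ : ∀ i, s₀ i ^ m = lam i) :
    ∑ i, tensorPower m (s₀ i • u i) = ∑ i, lam i • tensorPower m (u i) := by
  simp only [tensorPower_smul, hs₀]

/-- The index type consists of all families `q`, filtered only by the distance of their sums of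
powers from `F`; no closeness of `q` to the `s₀ i • u i` is assumed. -/
theorem exists_stability (h : GenericDecomposition m k p ξ lam u)
    {s₀ : Fin r → ℂ} (hs₀ : ∀ i, s₀ i ^ m = lam i) :
    ∃ ε > 0, ∃ C > 0, ∀ q : Fin r → Vec n,
      distOmega (∑ i, tensorPower m (q i)) (∑ i, lam i • tensorPower m (u i)) < ε →
      CloseUpToRoots m q (fun i => s₀ i • u i)
        (C * distOmega (∑ i, tensorPower m (q i)) (∑ i, lam i • tensorPower m (u i))) := by
  obtain ⟨C, hC, hev⟩ := h.eventually_closeUpToRoots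
    (d := fun q : Fin r → Vec n =>
      distOmega (∑ i, tensorPower m (q i)) (∑ i, lam i • tensorPower m (u i)))
    (tendsto_comap_zero _) (fun _ => distOmega_nonneg _ _) (q := fun q => q)
    (fun _ => le_rfl) hs₀
  obtain ⟨ε, hε, hP⟩ := exists_of_eventually_comap (fun _ => distOmega_nonneg _ _) hev
  exact ⟨ε, hε, C, hC, hP⟩

/-- Best approximations by sums of `r` powers exist near a generic tensor, and they are near its
decomposition. -/
theorem exists_bestApproximation (h : GenericDecomposition m k p ξ lam u)
    {s₀ : Fin r → ℂ} (hs₀ : ∀ i, s₀ i ^ m = lam i) :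
    ∃ ε > 0, ∃ C > 0, ∀ Fh : Tensor m n,
      distOmega Fh (∑ i, lam i • tensorPower m (u i)) < ε →
      (∃ q : Fin r → Vec n, IsMinOn (objQ Fh) Set.univ q) ∧
      ∀ q : Fin r → Vec n, IsMinOn (objQ Fh) Set.univ q →
        CloseUpToRoots m q (fun i => s₀ i • u i)
          (C * distOmega Fh (∑ i, lam i • tensorPower m (u i))) := by
  obtain ⟨ε, hε, C, hC, hstab⟩ := h.exists_stability hs₀
  set F : Tensor m n := ∑ i, lam i • tensorPower m (u i) with hFdef
  set q₀ : Fin r → Vec n := fun i => s₀ i • u i with hq₀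
  have hm : m ≠ 0 := by
    have := h.p_le
    omega
  refine ⟨ε / 2, by positivity, 2 * C, by positivity, fun Fh hFh => ?_⟩
  have hobj : objQ Fh q₀ = sqDistOmega Fh F := by
    rw [objQ, hq₀, sum_tensorPower_smul hs₀]
  -- A family at least as good as `q₀` has its sum within twice the distance from `Fh` to `F`,
  -- whence `ε / 2` and `2 * C`. This serves for minimizers, and also bounds the sublevel set of
  -- `q₀`, since roots of unity have norm one.
  have hle : ∀ q : Fin r → Vec n, objQ Fh q ≤ objQ Fh q₀ →
      CloseUpToRoots m q q₀ (2 * C * distOmega Fh F) := by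
    intro q hq
    have h1 : distOmega Fh (∑ i, tensorPower m (q i)) ≤ distOmega Fh F := by
      rw [hobj] at hq
      exact Real.sqrt_le_sqrt hq
    have h2 : distOmega (∑ i, tensorPower m (q i)) F ≤ 2 * distOmega Fh F := by
      refine (distOmega_triangle _ Fh _).trans ?_
      rw [distOmega_comm _ Fh]
      linarith
    refine (hstab q (by linarith)).mono ?_
    nlinarith
  refine ⟨?_, fun q hq => hle q (hq (Set.mem_univ _))⟩
  have hcont : Continuous (objQ (r := r) Fh) := by
    unfold objQ sqDistOmega tensorPower
    simp only [Finset.sum_apply]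
    fun_prop
  obtain ⟨q, hq⟩ := hcont.exists_forall_le_of_isBounded q₀ (by
    refine (Metric.isBounded_closedBall (x := (0 : Fin r → Vec n))
      (r := 2 * C * distOmega Fh F + ‖q₀‖)).subset fun q hq => ?_
    obtain ⟨σ, η, hη, hc⟩ := hle q hq
    have hnn : 0 ≤ 2 * C * distOmega Fh F :=
      mul_nonneg (by positivity) (distOmega_nonneg _ _)
    rw [mem_closedBall_zero_iff, pi_norm_le_iff_of_nonneg (by positivity)]
    intro i
    have h1 : ‖η i • q i‖ = ‖q i‖ := by
      rw [norm_smul, Complex.norm_eq_one_of_pow_eq_one (hη i) hm, one_mul]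
    have h2 := norm_le_norm_add_norm_sub' (η i • q i) (q₀ (σ i))
    have h3 := norm_le_pi_norm q₀ (σ i)
    linarith [hc i])
  exact ⟨q, fun y _ => hq y⟩

variable {T : Type*} {l : Filter T} {d : T → ℝ} {Fh : T → Tensor m n}

/-- The algorithm can be carried out on tensors near a generic one. -/
theorem eventually_nonempty_run (h : GenericDecomposition m k p ξ lam u)
    (hd : Tendsto d l (𝓝 0))
    (hF : ∀ τ ∈ Omega m n,
      Near l d (fun t => Fh t τ) ((∑ i, lam i • tensorPower m (u i)) τ))
    (hq : ∀ᶠ t in l, ∃ q : Fin r → Vec n, IsMinOn (objQ (Fh t)) Set.univ q) :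
    ∀ᶠ t in l, Nonempty (AlgorithmRun k p r (Fh t) ξ) := by
  choose g hg using fun t (α : ↥(B1 n k p)) =>
    exists_isMinOn_objG (k := k) (p := p) (r := r) (Fh t) α.1
  obtain ⟨G₀, hG₀⟩ := exists_isGenerating h.indep_B0
  have hnear := h.near_generating hd hF hG₀ (G := fun t β α => g t α β)
    (Eventually.of_forall fun t α => hg t α (Set.mem_univ _))
  filter_upwards [hq, eventually_exists_eigenvectors (card_B0_eq h.indep_B0) hd
    (near_matNxi hd hnear ξ) h.indep_B0 (hG₀.matNxi_mulVec ξ) h.simple]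
    with t ⟨q, hq⟩ ⟨z, e, hz1, hze, hzl⟩
  exact exists_algorithmRun (fun α => hg t α) hz1 hze hzl hq

/-- The system is block diagonal: row `(β, S)` meets only the unknowns with second index `β`.
Injectivity reduces to independence on `J₂` in each block. -/
theorem near_gam (h : GenericDecomposition m k p ξ lam u) (hd : Tendsto d l (𝓝 0))
    (hF : ∀ τ ∈ Omega m n,
      Near l d (fun t => Fh t τ) ((∑ i, lam i • tensorPower m (u i)) τ))
    {w : T → Fin r → Fin (n + 1) → ℂ}
    (hw : ∀ i, ∀ j ∈ high n k, Near l d (fun t => w t i j) (u i j))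
    {γ : T → Fin r → ↥(J1 n k p) → ℂ}
    (hγ : ∀ t γ', objGamma k p (Fh t) (w t) (γ t) ≤ objGamma k p (Fh t) (w t) γ')
    (i : Fin r) (β : ↥(J1 n k p)) :
    Near l d (fun t => γ t i β) (lam i * evalMono (u i).ofLp β.1) := by
  have hp := h.p_le
  have hsum : ∀ (w : Fin r → Fin (n + 1) → ℂ) (y : Fin r × ↥(J1 n k p) → ℂ)
      (a : ↥(J1 n k p) × Finset (Fin (n + 1))),
      ∑ c : Fin r × ↥(J1 n k p), (if c.2 = a.1 then evalMono (w c.1) a.2 else 0) * y c =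
        ∑ i, y (i, a.1) * evalMono (w i) a.2 := by
    intro w y a
    rw [Fintype.sum_prod_type]
    refine Finset.sum_congr rfl fun i _ => ?_
    simp only [ite_mul, zero_mul, Finset.sum_ite_eq', Finset.mem_univ, if_true]
    ring
  refine near_of_leastSquares (κ := Fin r × ↥(J1 n k p)) hd (Finset.univ ×ˢ J2 n m k p)
    (A := fun t a c => if c.2 = a.1 then evalMono (w t c.1) a.2 else 0)
    (A₀ := fun a c => if c.2 = a.1 then evalMono (u c.1).ofLp a.2 else 0)
    (b := fun t a => entry (Fh t) (a.1.1 ∪ a.2))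
    (b₀ := fun a => entry (∑ i, lam i • tensorPower m (u i)) (a.1.1 ∪ a.2))
    (x := fun t c => γ t c.1 c.2) (x₀ := fun c => lam c.1 * evalMono (u c.1).ofLp c.2.1)
    ?_ ?_ ?_ ?_ (Eventually.of_forall fun t => ?_) (i, β)
  · rintro ⟨β, S⟩ ha ⟨i, β'⟩
    dsimp only
    split_ifs with hβ
    · exact Near.evalMono hd fun j hj =>
        hw i j ((mem_J2.mp (Finset.mem_product.mp ha).2).1 hj)
    · exact Near.const 0
  · rintro ⟨β, S⟩ ha
    obtain ⟨hS, hSc⟩ := mem_J2.mp (Finset.mem_product.mp ha).2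
    obtain ⟨hβ, hβc⟩ := mem_J1.mp β.2
    exact hF _ (label_union_mem_Omega hβ hS (by dsimp only at *; omega))
  · intro y hy
    ext ⟨i, β⟩
    refine congrFun (h.indep_J2 (y := fun i => y (i, β)) fun S hS => ?_) i
    have := hy (β, S) (Finset.mem_product.mpr ⟨Finset.mem_univ _, hS⟩)
    rwa [hsum fun i => (u i).ofLp] at this
  · rintro ⟨β, S⟩ ha
    obtain ⟨hS, hSc⟩ := mem_J2.mp (Finset.mem_product.mp ha).2
    obtain ⟨hβ, hβc⟩ := mem_J1.mp β.2
    rw [hsum fun i => (u i).ofLp, entry_sum_union_one lam h.u_zero hβ hS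
      (by dsimp only at *; omega)]
  · have h1 := hγ t fun i β => lam i * evalMono (u i).ofLp β.1
    simp only [hsum]
    rw [Finset.sum_product, Finset.sum_product]
    exact h1

/-- The limit matrix has entries `lam i * u_i^β * u_i^S`. Independence on `J₂` separates the indices
`i`, and a `β` in `J₁^{-j}` with nonzero value at `u i` keeps the `i`-th column from vanishing; this
is the role of the nondegeneracy condition. -/
theorem near_v (h : GenericDecomposition m k p ξ lam u) (hd : Tendsto d l (𝓝 0))
    (hF : ∀ τ ∈ Omega m n,
      Near l d (fun t => Fh t τ) ((∑ i, lam i • tensorPower m (u i)) τ))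
    {w : T → Fin r → Fin (n + 1) → ℂ}
    (hw : ∀ i, ∀ j ∈ high n k, Near l d (fun t => w t i j) (u i j))
    {γ : T → Fin r → ↥(J1 n k p) → ℂ}
    (hγ : ∀ i β, Near l d (fun t => γ t i β) (lam i * evalMono (u i).ofLp β.1))
    {j : Fin (n + 1)} (hj : j ∈ low n k)
    (hnd : ∀ i, ∃ S ∈ J1minus n k p j, evalMono (u i).ofLp S ≠ 0) {x : T → Fin r → ℂ}
    (hx : ∀ t x', objV k p (Fh t) (w t) (γ t) j (x t) ≤ objV k p (Fh t) (w t) (γ t) j x')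
    (i : Fin r) : Near l d (fun t => x t i) (u i j) := by
  have hp := h.p_le
  set s : Finset (↥(J1 n k p) × Finset (Fin (n + 1))) :=
    (Finset.univ.filter fun β : ↥(J1 n k p) => j ∉ β.1) ×ˢ J2 n m k p with hs
  have hmem : ∀ a ∈ s, (j ∉ a.1.1 ∧ insert j a.1.1 ⊆ low n k ∧ (insert j a.1.1).card = p + 1) ∧
      a.2 ⊆ high n k ∧ a.2.card = m - p - 1 := by
    intro a ha
    obtain ⟨h1, h2⟩ := Finset.mem_product.mp ha
    have h3 := (Finset.mem_filter.mp h1).2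
    obtain ⟨hβ, hβc⟩ := mem_J1.mp a.1.2
    exact ⟨⟨h3, Finset.insert_subset hj hβ, by rw [Finset.card_insert_of_notMem h3, hβc]⟩,
      mem_J2.mp h2⟩
  refine near_of_leastSquares hd s
    (A := fun t a i => γ t i a.1 * evalMono (w t i) a.2)
    (A₀ := fun a i => lam i * evalMono (u i).ofLp a.1.1 * evalMono (u i).ofLp a.2)
    (b := fun t a => entry (Fh t) (insert j (a.1.1 ∪ a.2)))
    (b₀ := fun a => entry (∑ i, lam i • tensorPower m (u i)) (insert j (a.1.1 ∪ a.2)))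
    (x₀ := fun i => u i j) ?_ ?_ ?_ ?_ (Eventually.of_forall fun t => ?_) i
  · intro a ha i
    exact (hγ i a.1).mul hd (Near.evalMono hd fun j hj => hw i j ((hmem a ha).2.1 hj))
  · intro a ha
    obtain ⟨⟨h1, h2, h3⟩, h4, h5⟩ := hmem a ha
    simp only [← Finset.insert_union]
    exact hF _ (label_union_mem_Omega h2 h4 (by omega))
  · intro y hy
    ext i
    obtain ⟨S, hS, hne⟩ := hnd i
    obtain ⟨hSJ, hjS⟩ := Finset.mem_filter.mp hS
    have h0 : (fun i => lam i * evalMono (u i).ofLp S * y i) = 0 := by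
      refine h.indep_J2 fun R hR => ?_
      rw [← hy (⟨S, hSJ⟩, R) (Finset.mem_product.mpr
        ⟨Finset.mem_filter.mpr ⟨Finset.mem_univ _, hjS⟩, hR⟩)]
      exact Finset.sum_congr rfl fun i _ => by ring
    simpa [hne, h.lam_ne i] using congrFun h0 i
  · intro a ha
    obtain ⟨⟨h1, h2, h3⟩, h4, h5⟩ := hmem a ha
    rw [← Finset.insert_union, entry_sum_union_one lam h.u_zero h2 h4 (by omega)]
    refine Finset.sum_congr rfl fun i _ => ?_
    rw [evalMono_insert h1]
    ring
  · have h1 := hx t fun i => u i j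
    rw [hs, Finset.sum_product, Finset.sum_product]
    refine le_trans (le_of_eq ?_) (h1.trans (le_of_eq ?_)) <;>
      refine Finset.sum_congr rfl fun β _ => Finset.sum_congr rfl fun S _ => ?_ <;>
      simp only [mul_comm, mul_left_comm, mul_assoc]

theorem near_lam (h : GenericDecomposition m k p ξ lam u) (hd : Tendsto d l (𝓝 0))
    (hF : ∀ τ ∈ Omega m n,
      Near l d (fun t => Fh t τ) ((∑ i, lam i • tensorPower m (u i)) τ))
    {x : T → Fin r → Vec n} (hx : ∀ i j, Near l d (fun t => x t i j) (u i j))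
    {c : T → Fin r → ℂ}
    (hc : ∀ t c', objLambda (Fh t) (x t) (c t) ≤ objLambda (Fh t) (x t) c') (i : Fin r) :
    Near l d (fun t => c t i) (lam i) := by
  refine near_of_leastSquares hd (Omega m n)
    (A := fun t τ i => tensorPower m (x t i) τ) (A₀ := fun τ i => tensorPower m (u i) τ)
    (b := Fh) (b₀ := ∑ i, lam i • tensorPower m (u i)) ?_ hF ?_ ?_
    (Eventually.of_forall fun t => ?_) i
  · intro τ _ i
    exact Near.prod hd _ fun a _ => hx i (τ a)
  · intro y hy
    exact h.indep_Omega fun τ hτ => by simpa only [mul_comm] using hy τ hτ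
  · intro τ _
    simp [Finset.sum_apply, mul_comm]
  · have h1 := hc t lam
    simpa only [objLambda, sqDistOmega, Finset.sum_apply, Pi.smul_apply, smul_eq_mul,
      mul_comm] using h1

/-- Under the nondegeneracy condition, the output of the algebraic steps of the algorithm is near
the decomposition. -/
theorem eventually_closeUpToRoots_qhat (h : GenericDecomposition m k p ξ lam u)
    (hd : Tendsto d l (𝓝 0)) (hd0 : ∀ t, 0 ≤ d t)
    (hF : ∀ τ ∈ Omega m n,
      Near l d (fun t => Fh t τ) ((∑ i, lam i • tensorPower m (u i)) τ))
    (hnd : ∀ i, ∀ j ∈ low n k, ∃ S ∈ J1minus n k p j, evalMono (u i).ofLp S ≠ 0)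
    (R : ∀ t, AlgorithmRun k p r (Fh t) ξ)
    {s₀ : Fin r → ℂ} (hs₀ : ∀ i, s₀ i ^ m = lam i) :
    ∃ C > 0, ∀ᶠ t in l, CloseUpToRoots m (R t).qhat (fun i => s₀ i • u i) (C * d t) := by
  have hm : m ≠ 0 := by
    have := h.p_le
    omega
  obtain ⟨G₀, hG₀⟩ := exists_isGenerating h.indep_B0
  have hG := h.near_generating hd hF hG₀ (G := fun t => (R t).G)
    (Eventually.of_forall fun t α => (R t).G_min α (Set.mem_univ _))
  obtain ⟨σ, hσ⟩ := h.exists_perm_near_wVec hd hG₀ hG (z := fun t => (R t).vec)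
    (e := fun t => (R t).eig) (Eventually.of_forall fun t => (R t).vec_norm)
    (Eventually.of_forall fun t => (R t).vec_eig)
    (Eventually.of_forall fun t => (R t).vec_indep)
  -- The order of the eigenvectors is fixed once by `σ`; all later problems are invariant under
  -- simultaneous permutation, so their minimizers may be relabelled.
  have hγ := h.near_gam hd hF hσ (γ := fun t i => (R t).gam (σ t i)) fun t γ' =>
    le_of_isMinOn_comp_perm (R t).gam_min (σ t) (fun y => objGamma_comp_perm _ _ y (σ t)) γ'
  have hv : ∀ i (j : ↥(low n k)), Near l d (fun t => (R t).v (σ t i) j) (u i j.1) :=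
    fun i j => h.near_v hd hF hσ hγ j.2 (fun i => hnd i j.1 j.2)
      (x := fun t i => (R t).v (σ t i) j) (fun t x' =>
        le_of_isMinOn_comp_perm ((R t).v_min j) (σ t)
          (fun y => objV_comp_perm _ _ _ _ y (σ t)) x') i
  let x : T → Fin r → Vec n := fun t i => assemble ((R t).v i) (wVec (R t).G ((R t).vec i))
  have hx : ∀ i j, Near l d (fun t => x t (σ t i) j) (u i j) := by
    intro i j
    simp only [x, assemble]
    split_ifs with h1 h2
    · rw [h1, h.u_zero]
      exact Near.const 1
    · exact hv i ⟨j, h2⟩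
    · exact hσ i j ((mem_low_or_high h1).resolve_left h2)
  have hlam := h.near_lam hd hF (x := fun t i => x t (σ t i)) hx
    (c := fun t i => (R t).lam (σ t i)) fun t c' =>
      le_of_isMinOn_comp_perm (R t).lam_min (σ t) (fun y => objLambda_comp_perm _ _ y (σ t)) c'
  obtain ⟨η, hη, hnear⟩ := h.exists_root_near hd
    (s := fun t i => (R t).lam i ^ (1 / (m : ℂ))) (x := x) (σ := σ) (fun i => by
      simp only [one_div, Complex.cpow_nat_inv_pow _ hm]
      exact hlam i) hx hs₀
  exact exists_closeUpToRoots_of_near (σ := σ) hd0 hη hnear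

end GenericDecomposition

/-! ### Passage between decompositions of the same tensor -/

section Transfer

variable {m n r : ℕ}

theorem near_distOmega {T : Type*} {l : Filter T} (Fh : T → Tensor m n) (F : Tensor m n)
    {τ : Fin m → Fin (n + 1)} (hτ : τ ∈ Omega m n) :
    Near l (fun t => distOmega (Fh t) F) (fun t => Fh t τ) (F τ) :=
  near_of_distOmega_le (fun _ => le_rfl) hτ

/-- Closeness to a family does not depend on its representative up to roots of unity and
permutations. -/
theorem CloseUpToRoots.of_exact (hm : m ≠ 0) {a b c : Fin r → Vec n} {δ : ℝ}
    (hab : CloseUpToRoots m a b δ) (hcb : CloseUpToRoots m c b 0) : CloseUpToRoots m a c δ := by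
  obtain ⟨σ, η, hη, hab⟩ := hab
  obtain ⟨τ, θ, hθ, hcb⟩ := hcb
  have hb : ∀ i, b (τ i) = θ i • c i := fun i =>
    (sub_eq_zero.mp (norm_le_zero_iff.mp (hcb i))).symm
  have hθ1 : ∀ i, ‖θ i‖ = 1 := fun i => Complex.norm_eq_one_of_pow_eq_one (hθ i) hm
  have hθ0 : ∀ i, θ i ≠ 0 := fun i => norm_ne_zero_iff.mp (by rw [hθ1 i]; exact one_ne_zero)
  refine ⟨σ.trans τ.symm, fun i => (θ (τ.symm (σ i)))⁻¹ * η i, fun i => ?_, fun i => ?_⟩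
  · rw [mul_pow, inv_pow, hθ, hη, inv_one, one_mul]
  · have h1 := hab i
    obtain ⟨j, hj⟩ := τ.surjective (σ i)
    rw [← hj, hb] at h1
    simp only [Equiv.trans_apply, ← hj, Equiv.symm_apply_apply]
    have h2 : ((θ j)⁻¹ * η i) • a i - c j = (θ j)⁻¹ • (η i • a i - θ j • c j) := by
      rw [smul_sub, smul_smul, inv_smul_smul₀ (hθ0 j)]
    rw [h2, norm_smul, norm_inv, hθ1, inv_one, one_mul]
    exact h1

theorem CloseUpToRoots.exists_evalMono_ne (hm : m ≠ 0) {a b : Fin r → Vec n}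
    (hab : CloseUpToRoots m a b 0) {P : Finset (Finset (Fin (n + 1)))}
    (h : ∀ i, ∃ S ∈ P, evalMono (a i).ofLp S ≠ 0) (i : Fin r) :
    ∃ S ∈ P, evalMono (b i).ofLp S ≠ 0 := by
  obtain ⟨τ, θ, hθ, hab⟩ := hab
  obtain ⟨j, rfl⟩ := τ.surjective i
  obtain ⟨S, hS, hne⟩ := h j
  have hθ0 : θ j ≠ 0 := fun h0 => by simpa [h0, hm] using hθ j
  refine ⟨S, hS, ?_⟩
  rw [← sub_eq_zero.mp (norm_le_zero_iff.mp (hab j)), evalMono_smul]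
  exact mul_ne_zero (pow_ne_zero _ hθ0) hne

end Transfer

/-! ### Uniform bounds for the algorithm and normalisation -/

namespace GenericDecomposition

variable {m n k p r : ℕ} {ξ : ↥(high n k) → ℂ} {lam : Fin r → ℂ} {u : Fin r → Vec n}

/-- Correctness of the algorithm near a tensor with a generic decomposition. -/
theorem exists_algorithm_bound (h : GenericDecomposition m k p ξ lam u)
    {s₀ : Fin r → ℂ} (hs₀ : ∀ i, s₀ i ^ m = lam i) :
    ∃ ε > 0, ∃ C > 0, ∀ Fh : Tensor m n,
      distOmega Fh (∑ i, lam i • tensorPower m (u i)) < ε →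
      Nonempty (AlgorithmRun k p r Fh ξ) ∧ ∀ R : AlgorithmRun k p r Fh ξ,
        CloseUpToRoots m R.qstar (fun i => s₀ i • u i)
          (C * distOmega Fh (∑ i, lam i • tensorPower m (u i))) ∧
        ((∀ i, ∀ j ∈ low n k, ∃ S ∈ J1minus n k p j, evalMono (u i).ofLp S ≠ 0) →
          CloseUpToRoots m R.qhat (fun i => s₀ i • u i)
            (C * distOmega Fh (∑ i, lam i • tensorPower m (u i)))) := by
  set F : Tensor m n := ∑ i, lam i • tensorPower m (u i) with hFdef
  obtain ⟨ε₁, hε₁, C₁, hC₁, h₁⟩ := h.exists_bestApproximation hs₀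
  have hd : Tendsto (fun Fh : Tensor m n => distOmega Fh F)
      (comap (fun Fh : Tensor m n => distOmega Fh F) (𝓝 0)) (𝓝 0) := tendsto_comap_zero _
  have hq : ∀ᶠ Fh in comap (fun Fh : Tensor m n => distOmega Fh F) (𝓝 0),
      ∃ q : Fin r → Vec n, IsMinOn (objQ Fh) Set.univ q := by
    filter_upwards [hd.eventually (gt_mem_nhds hε₁)] with Fh hFh
    exact (h₁ Fh hFh).1
  have hrun := h.eventually_nonempty_run hd (Fh := fun Fh => Fh)
    (fun τ hτ => near_distOmega (fun Fh => Fh) F hτ) hq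
  obtain ⟨ε₂, hε₂, h₂⟩ := exists_of_eventually_comap (fun Fh => distOmega_nonneg Fh F) hrun
  obtain ⟨ε₃, hε₃, C₃, hC₃, h₃⟩ : ∃ ε > 0, ∃ C > 0, ∀ Fh : Tensor m n, distOmega Fh F < ε →
      ∀ R : AlgorithmRun k p r Fh ξ,
        (∀ i, ∀ j ∈ low n k, ∃ S ∈ J1minus n k p j, evalMono (u i).ofLp S ≠ 0) →
          CloseUpToRoots m R.qhat (fun i => s₀ i • u i) (C * distOmega Fh F) := by
    by_cases hnd : ∀ i, ∀ j ∈ low n k, ∃ S ∈ J1minus n k p j, evalMono (u i).ofLp S ≠ 0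
    -- Indexing by pairs of a tensor and a run makes the constant independent of all choices in the
    -- run.
    · let D : (Σ Fh : Tensor m n, AlgorithmRun k p r Fh ξ) → ℝ := fun t => distOmega t.1 F
      have hF : ∀ τ ∈ Omega m n, Near (comap D (𝓝 0)) D (fun t => t.1 τ) (F τ) := fun τ hτ =>
        near_distOmega (fun t : Σ Fh : Tensor m n, AlgorithmRun k p r Fh ξ => t.1) F hτ
      obtain ⟨C, hC, hev⟩ := h.eventually_closeUpToRoots_qhat (Fh := Sigma.fst)
        (tendsto_comap_zero D) (fun t => distOmega_nonneg t.1 F) hF hnd Sigma.snd hs₀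
      obtain ⟨ε, hε, hP⟩ := exists_of_eventually_comap (d := D)
        (fun t => distOmega_nonneg t.1 F) hev
      exact ⟨ε, hε, C, hC, fun Fh hFh R _ => hP ⟨Fh, R⟩ hFh⟩
    · exact ⟨1, one_pos, 1, one_pos, fun _ _ _ h' => absurd h' hnd⟩
  refine ⟨min ε₁ (min ε₂ ε₃), by positivity, max C₁ C₃, by positivity, fun Fh hFh => ?_⟩
  simp only [lt_min_iff] at hFh
  have hnn := distOmega_nonneg Fh F
  refine ⟨h₂ Fh hFh.2.1, fun R => ⟨((h₁ Fh hFh.1).2 _ R.qstar_min).mono ?_,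
    fun hnd => (h₃ Fh hFh.2.2 R hnd).mono ?_⟩⟩
  · exact mul_le_mul_of_nonneg_right (le_max_left _ _) hnn
  · exact mul_le_mul_of_nonneg_right (le_max_right _ _) hnn

/-- Normalisation of a decomposition. -/
theorem of_decomposition (hp : 1 ≤ p) (hpm : p ≤ m - 2)
    (hr : r ≤ min (k.choose p) ((n - k - 1).choose (m - p - 1)))
    {ω : Fin r → ℂ} {μ : Fin r → Vec n} (hne : ∀ i, ω i ≠ 0 ∧ μ i 0 ≠ 0)
    (hB : LinearIndependent ℂ fun i => monoB0 k p r (μ i))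
    (hO : ∀ α ∈ B1 n k p, LinearIndependent ℂ
      fun (i : Fin r) (γ : ↥(O n m k p α)) => evalMono (μ i).ofLp γ.1)
    (heig : ∀ G, SolvesG k p r (∑ i, ω i • tensorPower m (μ i)) G →
      (matNxi ξ G).charpoly.roots.Nodup) :
    GenericDecomposition m k p ξ (fun i => ω i * μ i 0 ^ m) (fun i => (μ i 0)⁻¹ • μ i) ∧
      ∑ i, (ω i * μ i 0 ^ m) • tensorPower m ((μ i 0)⁻¹ • μ i) =
        ∑ i, ω i • tensorPower m (μ i) := by
  have hsum : ∑ i, (ω i * μ i 0 ^ m) • tensorPower m ((μ i 0)⁻¹ • μ i) =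
      ∑ i, ω i • tensorPower m (μ i) := by
    refine Finset.sum_congr rfl fun i _ => ?_
    rw [mul_smul, ← tensorPower_smul, smul_inv_smul₀ (hne i).2]
  have hu0 : ∀ i, ((μ i 0)⁻¹ • μ i) 0 = 1 := fun i => by simp [(hne i).2]
  have hB' : LinearIndependent ℂ fun i => monoB0 k p r ((μ i 0)⁻¹ • μ i) := by
    have := hB.units_smul fun i =>
      Units.mk0 ((μ i 0)⁻¹ ^ p) (pow_ne_zero _ (inv_ne_zero (hne i).2))
    convert this using 1
    ext1 i
    simp only [smul_monoB0]
    rfl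
  refine ⟨⟨hp, by omega, fun hr0 => ?_, fun i => mul_ne_zero (hne i).1
    (pow_ne_zero _ (hne i).2), hu0, hB', fun α hα => ?_, ?_⟩, hsum⟩
  -- A positive binomial coefficient with `m - p - 1 ≥ 1` gives `n - k - 1 ≥ 1`, so `n` itself is a
  -- high index.
  · have h1 : 0 < (n - k - 1).choose (m - p - 1) :=
      hr0.trans_le (hr.trans (min_le_right _ _))
    have h2 : m - p - 1 ≤ n - k - 1 := by
      by_contra! hlt
      rw [Nat.choose_eq_zero_of_lt hlt] at h1
      exact absurd h1 (lt_irrefl 0)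
    exact ⟨Fin.last n, by
      simp only [high, Finset.mem_filter, Finset.mem_univ, true_and, Fin.val_last]
      omega⟩
  · have := (hO α hα).units_smul fun i =>
      Units.mk0 ((μ i 0)⁻¹ ^ (m - p - 1)) (pow_ne_zero _ (inv_ne_zero (hne i).2))
    convert this using 1
    ext i γ
    rw [evalMono_smul, (mem_J2.mp (mem_O.mp γ.2).1).2]
    rfl
  · obtain ⟨G, hG⟩ := exists_isGenerating hB'
    have h1 := heig G (by
      rw [← hsum]
      exact hG.solvesG (by omega) _ hu0)
    -- The roots of the characteristic polynomial, with multiplicity, are the numbers `∑ l, ξ l * u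
    -- i l`; absence of repetitions is injectivity in `i`.
    rw [charpoly_eq_prod_of_eigenvectors (card_B0_eq hB') hB' (hG.matNxi_mulVec ξ)] at h1
    have h2 := Polynomial.roots_multiset_prod_X_sub_C
      (Multiset.map (fun i => ∑ l, ξ l * ((μ i 0)⁻¹ • μ i) l.1) Finset.univ.val)
    rw [Multiset.map_map] at h2
    have h3 : (Multiset.map (fun i => ∑ l, ξ l * ((μ i 0)⁻¹ • μ i) l.1)
        (Finset.univ : Finset (Fin r)).val).Nodup := by
      rw [← h2]
      exact h1
    intro i j hij
    exact Multiset.inj_on_of_nodup_map h3 i (Finset.mem_univ i) j (Finset.mem_univ j) hij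

end GenericDecomposition

end IncompleteTensor

end

open IncompleteTensor in
theorem theorem4p1 (m n k p r : ℕ) (hp : 1 ≤ p) (hpm : p ≤ m - 2)
    (hr : r ≤ min (k.choose p) ((n - k - 1).choose (m - p - 1)))
    (F : IncompleteTensor.Tensor m n) (ξ : ↥(IncompleteTensor.high n k) → ℂ) :
    ∃ ε₀ > (0 : ℝ), ∃ C > (0 : ℝ),
      ∀ (ω : Fin r → ℂ) (μ : Fin r → IncompleteTensor.Vec n),
        F = ∑ i, ω i • IncompleteTensor.tensorPower m (μ i) →
        -- (i)
        (∀ i, ω i ≠ 0 ∧ μ i 0 ≠ 0) →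
        -- (ii)
        LinearIndependent ℂ (fun (i : Fin r) (β : ↥(IncompleteTensor.B0 n k p r)) =>
          IncompleteTensor.evalMono (μ i).ofLp β.1) →
        -- (iii)
        (∀ α ∈ IncompleteTensor.B1 n k p,
          LinearIndependent ℂ (fun (i : Fin r) (γ : ↥(IncompleteTensor.O n m k p α)) =>
            IncompleteTensor.evalMono (μ i).ofLp γ.1)) →
        -- (iv)
        (∀ G, IncompleteTensor.SolvesG k p r F G →
          (IncompleteTensor.matNxi ξ G).charpoly.roots.Nodup) →
        ∀ Fhat : IncompleteTensor.Tensor m n, IncompleteTensor.IsSymmetric Fhat →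
          IncompleteTensor.distOmega Fhat F < ε₀ →
          Nonempty (IncompleteTensor.AlgorithmRun k p r Fhat ξ) ∧
          ∀ R : IncompleteTensor.AlgorithmRun k p r Fhat ξ,
            IncompleteTensor.CloseUpToRoots m R.qstar
              (fun i => (ω i ^ (1 / (m : ℂ))) • μ i)
              (C * IncompleteTensor.distOmega Fhat F) ∧
            -- nondegeneracy, needed for the least squares problem that determines the `v̂ᵢ`
            ((∀ i, ∀ j ∈ IncompleteTensor.low n k, ∃ S ∈ IncompleteTensor.J1minus n k p j,
                IncompleteTensor.evalMono (μ i).ofLp S ≠ 0) →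
              IncompleteTensor.CloseUpToRoots m R.qhat
                (fun i => (ω i ^ (1 / (m : ℂ))) • μ i)
                (C * IncompleteTensor.distOmega Fhat F)) := by
  have hm : m ≠ 0 := by omega
  have hroot : ∀ z : ℂ, (z ^ (1 / (m : ℂ))) ^ m = z := fun z => by
    rw [one_div, Complex.cpow_nat_inv_pow _ hm]
  -- The constants precede the decomposition in the statement, so they are taken from one fixed
  -- generic decomposition; without one the hypotheses cannot be met.
  by_cases hex : ∃ (lam s₀ : Fin r → ℂ) (u : Fin r → Vec n),
      GenericDecomposition m k p ξ lam u ∧ F = ∑ i, lam i • tensorPower m (u i) ∧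
        ∀ i, s₀ i ^ m = lam i
  · obtain ⟨lam, s₀, u, h, rfl, hs₀⟩ := hex
    obtain ⟨ε, hε, C, hC, hmain⟩ := h.exists_algorithm_bound hs₀
    obtain ⟨ε', hε', C', -, hstab⟩ := h.exists_stability hs₀
    refine ⟨ε, hε, C, hC, fun ω μ hF hne _ _ _ Fhat _ hFhat => ?_⟩
    have hq : ∑ i, tensorPower m ((ω i ^ (1 / (m : ℂ))) • μ i) =
        ∑ i, lam i • tensorPower m (u i) := by
      simp only [tensorPower_smul, hroot, hF]
    have hzero : distOmega (∑ i, tensorPower m ((ω i ^ (1 / (m : ℂ))) • μ i))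
        (∑ i, lam i • tensorPower m (u i)) = 0 := by
      rw [hq]
      simp [distOmega, sqDistOmega]
    -- Stability at distance zero: the given decomposition agrees with the fixed one up to order and
    -- roots of unity, and the bounds transfer.
    have huniq := hstab (fun i => (ω i ^ (1 / (m : ℂ))) • μ i) (by rw [hzero]; exact hε')
    rw [hzero, mul_zero] at huniq
    obtain ⟨hrun, hclose⟩ := hmain Fhat hFhat
    refine ⟨hrun, fun R => ⟨(hclose R).1.of_exact hm huniq, fun hnd =>
      ((hclose R).2 fun i j hj => ?_).of_exact hm huniq⟩⟩
    obtain ⟨S, hS, hS0⟩ := huniq.exists_evalMono_ne hm (P := J1minus n k p j) (fun i => by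
      obtain ⟨S, hS, hS0⟩ := hnd i j hj
      refine ⟨S, hS, ?_⟩
      rw [evalMono_smul]
      refine mul_ne_zero (pow_ne_zero _ fun h0 => (hne i).1 ?_) hS0
      rw [← hroot (ω i), h0, zero_pow hm]) i
    rw [evalMono_smul] at hS0
    exact ⟨S, hS, right_ne_zero_of_mul hS0⟩
  · refine ⟨1, one_pos, 1, one_pos, fun ω μ hF hne hB hO heig => absurd ?_ hex⟩
    subst hF
    obtain ⟨h1, h2⟩ := GenericDecomposition.of_decomposition hp hpm hr hne hB hO heig
    exact ⟨_, fun i => ω i ^ (1 / (m : ℂ)) * μ i 0, _, h1, h2.symm, fun i => by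
      rw [mul_pow, hroot]⟩
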